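/- **Setting.** Let $(\mathbb X,\rho)$ be a non-empty, separable, locally compact metric space with its Borel $\sigma$-algebra, and let $X=\{X_t,\ t\ge 0\}$ be a time homogeneous strong Markov process in $\mathbb X$ with càdlàg trajectories. $P_x$ and $E_x$ denote its distribution and the expectation when $X_0=x$, and $P_t(x,dy)$ its transition function. The strong Markov property is understood with respect to the right-continuous filtration $\mathcal F_{t+}=\bigcap_{s>t}\sigma(X_r,\ r\le s)$. A probability measure $\pi$ on $\mathbb X$ is *invariant* if $\int P_t(x,\cdot)\,\pi(dx)=\pi$ for all $t\ge0$. For a closed set $K$ let $\tau_K=\inf\{t\ge 0: X_t\in K\}$ (with $\inf\emptyset=+\infty$), and let $\|\cdot\|_{var}$ be the total variation norm of signed measures, $\|\varkappa\|_{var}=|\varkappa|(\mathbb X)$. **Definitions.** * $X$ satisfies the *Doeblin condition* on a set $A\subset\mathbb X$ if for some $T>0$ $$\sup_{x,y\in A}\tfrac12\|P_T(x,\cdot)-P_T(y,\cdot)\|_{var}<1 ,$$ and the *extended Doeblin condition* on $A$ if for some $0<T_1<T_2$ $$\sup_{x,y\in A,\ s,t\in[T_1,T_2]}\tfrac12\|P_s(x,\cdot)-P_t(y,\cdot)\|_{var}<1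 .$$ (A supremum over the empty set is $0$.) * For probability measures $\mu,\nu$, a *$(\mu,\nu)$-coupling* for $X$ is a pair $Z=(Z^1,Z^2)$ of càdlàg processes on a common probability space such that $Z^1$ and $Z^2$ have the same distributions as the process $X$ with initial distribution $\mu$ and $\nu$, respectively. * For a measurable $\phi:\mathbb X\to[1,+\infty)$, $X$ *admits an exponential $\phi$-coupling* if there exist an invariant probability measure $\pi$ for $X$ and constants $C>0$, $\beta>0$ such that for every $x\in\mathbb X$ there is a $(\delta_x,\pi)$-coupling $Z=(Z^1,Z^2)$ with $$E\big[\phi(Z^1_t)+\phi(Z^2_t)\big]\mathbf 1_{Z^1_t\neq Z^2_t}\le C e^{-\beta t}\phi(x),\qquad t\ge 0 .$$ **Theorem.** Let there exist a Borel measurable function $\phi:\mathbb X\to[1,+\infty)$, a closed set $K\subset\mathbb X$ and $\alpha>0$ such that 1. $E_x\,\phi(X_t)\mathbf 1_{\tau_K>t}\le e^{-\alpha t}\phi(x)$ for all $x\in\mathbb X$ and $t\ge0$; 2. $\displaystyle\sup_{x\in K,\ t\ge 0}E_x\,\phi(X_t)\mathbf 1_{\phi(X_t)>c}\to0$ as $c\to+\infty$.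 Assume that either $X$ satisfies the Doeblin condition on $\{\phi\le c\}$ for every $c\in[1,+\infty)$, or $X$ satisfies the extended Doeblin condition on $K$. Then $X$ admits an exponential $\phi$-coupling. -/

import Mathlib

open MeasureTheory ProbabilityTheory Filter Topology
open scoped NNReal ENNReal

universe u

/-- The space of càdlàg trajectories `ω : [0, ∞) → X`: right-continuous, with left limits in `X`.
(At `t = 0` the left limit condition is void, since `𝓝[<] 0 = ⊥` in `ℝ≥0`.)
It inherits from the product `ℝ≥0 → X` the σ-algebra generated by the coordinate maps. -/
abbrev CadlagPath (X : Type u) [TopologicalSpace X] : Type u :=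
  {ω : ℝ≥0 → X // ∀ t : ℝ≥0,
    ContinuousWithinAt ω (Set.Ici t) t ∧ ∃ l : X, Tendsto ω (𝓝[<] t) (𝓝 l)}

namespace CadlagPath

section Topological

variable {X : Type u} [TopologicalSpace X]

/-- The position at time `t`. -/
def eval (t : ℝ≥0) (ω : CadlagPath X) : X := ω.1 t

/-- The shifted trajectory `s ↦ ω (r + s)`. -/
def shift (r : ℝ≥0) (ω : CadlagPath X) : CadlagPath X :=
  ⟨fun s => ω.1 (r + s), fun t => by
    have hcont : Continuous fun s : ℝ≥0 => r + s := by fun_prop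
    refine ⟨?_, ?_⟩
    · refine ContinuousWithinAt.comp (t := Set.Ici (r + t)) (ω.2 (r + t)).1
        hcont.continuousWithinAt ?_
      intro s hs
      exact add_le_add le_rfl (Set.mem_Ici.1 hs)
    · obtain ⟨l, hl⟩ := (ω.2 (r + t)).2
      refine ⟨l, hl.comp ?_⟩
      refine tendsto_nhdsWithin_iff.2 ⟨hcont.continuousWithinAt.tendsto, ?_⟩
      filter_upwards [self_mem_nhdsWithin] with s hs
      exact add_lt_add_of_le_of_lt le_rfl (Set.mem_Iio.1 hs)⟩

variable [MeasurableSpace X]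

lemma measurable_eval (t : ℝ≥0) : Measurable (eval t : CadlagPath X → X) :=
  (measurable_pi_apply t).comp measurable_subtype_coe

/-- The natural filtration `𝓕⁰ₜ = σ(ωₛ, s ≤ t)` of the coordinate process. -/
def naturalFiltration (X : Type u) [TopologicalSpace X] [MeasurableSpace X] :
    Filtration ℝ≥0 (inferInstance : MeasurableSpace (CadlagPath X)) where
  seq t := ⨆ s ≤ t, MeasurableSpace.comap (eval s) inferInstance
  mono' _ _ hst := biSup_mono fun _ h => h.trans hst
  le' _ := iSup₂_le fun s _ => (measurable_eval s).comap_le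

end Topological

end CadlagPath

/-- A time homogeneous strong Markov process with càdlàg trajectories in `X`, given by the
distributions `P_x = law x` on trajectory space of the process started at `x`. The strong Markov
property is required at all stopping times `τ` of the right-continuous filtration `(𝓕⁰ₜ₊)`:
on `{τ < ∞}`, the conditional distribution given `𝓕_τ` of the trajectory after time `τ` is the
distribution of the process started at `ω_τ`. -/
structure StrongMarkovProcess (X : Type u) [TopologicalSpace X] [MeasurableSpace X] where
  law : Kernel X (CadlagPath X)
  isMarkovKernel : IsMarkovKernel law
  start : ∀ x : X, ∀ᵐ ω ∂(law x), CadlagPath.eval 0 ω = x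
  strongMarkov : ∀ (x : X) (τ : CadlagPath X → WithTop ℝ≥0)
    (hτ : IsStoppingTime (CadlagPath.naturalFiltration X).rightCont τ)
    (A : Set (CadlagPath X)), MeasurableSet[hτ.measurableSpace] A →
    ∀ B : Set (CadlagPath X), MeasurableSet B →
      law x (A ∩ {ω | τ ω ≠ ⊤ ∧ CadlagPath.shift ((τ ω).untopD 0) ω ∈ B}) =
        ∫⁻ ω in A ∩ {ω | τ ω ≠ ⊤},
          law (CadlagPath.eval ((τ ω).untopD 0) ω) B ∂(law x)

/-- The variation norm `‖μ - ν‖_var = |μ - ν|(X)` of the difference of two finite measures. -/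
noncomputable def varDist {X : Type u} [MeasurableSpace X] (μ ν : Measure X)
    [IsFiniteMeasure μ] [IsFiniteMeasure ν] : ℝ≥0∞ :=
  (μ.toSignedMeasure - ν.toSignedMeasure).totalVariation Set.univ

namespace StrongMarkovProcess

variable {X : Type u} [TopologicalSpace X] [MeasurableSpace X]

instance instIsMarkovKernelLaw (M : StrongMarkovProcess X) : IsMarkovKernel M.law :=
  M.isMarkovKernel

/-- The transition function `P_t(x, dy)`: the distribution of `X_t` under `P_x`. -/
noncomputable def transition (M : StrongMarkovProcess X) (t : ℝ≥0) : Kernel X X :=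
  M.law.map (CadlagPath.eval t)

instance instIsMarkovKernelTransition (M : StrongMarkovProcess X) (t : ℝ≥0) :
    IsMarkovKernel (M.transition t) :=
  Kernel.IsMarkovKernel.map M.law (CadlagPath.measurable_eval t)

/-- The distribution on trajectory space of the process with initial distribution `μ`. -/
noncomputable def lawFrom (M : StrongMarkovProcess X) (μ : Measure X) : Measure (CadlagPath X) :=
  μ.bind M.law

/-- An invariant (probability) measure of the process. -/
def IsInvariantMeasure (M : StrongMarkovProcess X) (π : Measure X) : Prop :=
  IsProbabilityMeasure π ∧ ∀ t : ℝ≥0, Kernel.Invariant (M.transition t) π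

/-- `(Z¹, Z²)` is a `(μ, ν)`-coupling for the process: a pair of càdlàg processes on a common
probability space `(Ω, Pr)`, distributed as the process with initial distribution `μ`,
respectively `ν`. -/
structure IsCoupling (M : StrongMarkovProcess X) (μ ν : Measure X)
    {Ω : Type u} [MeasurableSpace Ω] (Pr : Measure Ω) (Z₁ Z₂ : Ω → CadlagPath X) : Prop where
  isProbabilityMeasure : IsProbabilityMeasure Pr
  measurable_fst : Measurable Z₁
  measurable_snd : Measurable Z₂
  map_fst : Pr.map Z₁ = M.lawFrom μ
  map_snd : Pr.map Z₂ = M.lawFrom ν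

/-- The process admits an exponential `φ`-coupling. -/
def AdmitsExponentialCoupling (M : StrongMarkovProcess X) (φ : X → ℝ) : Prop :=
  ∃ π : Measure X, M.IsInvariantMeasure π ∧
    ∃ C > (0 : ℝ), ∃ β > (0 : ℝ), ∀ x : X,
      ∃ (Ω : Type u) (_ : MeasurableSpace Ω) (Pr : Measure Ω) (Z₁ Z₂ : Ω → CadlagPath X),
        M.IsCoupling (Measure.dirac x) π Pr Z₁ Z₂ ∧
        ∀ t : ℝ≥0,
          ∫⁻ ω in {ω | (Z₁ ω).eval t ≠ (Z₂ ω).eval t},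
              ENNReal.ofReal (φ ((Z₁ ω).eval t) + φ ((Z₂ ω).eval t)) ∂Pr
            ≤ ENNReal.ofReal (C * Real.exp (-β * t) * φ x)

/-- The hitting time `τ_K = inf {t ≥ 0 : X_t ∈ K}`, equal to `⊤` if `K` is never hit. -/
noncomputable def hittingTime (K : Set X) : CadlagPath X → WithTop ℝ≥0 :=
  hittingAfter CadlagPath.eval K 0

/-- `ϰ(T, A) = sup_{x, y ∈ A} ½ ‖P_T(x, ·) - P_T(y, ·)‖_var`. -/
noncomputable def doeblinCoeff (M : StrongMarkovProcess X) (T : ℝ≥0) (A : Set X) : ℝ≥0∞ :=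
  ⨆ x ∈ A, ⨆ y ∈ A, varDist (M.transition T x) (M.transition T y) / 2

/-- `ϰ(T₁, T₂, A) = sup_{x, y ∈ A, s, t ∈ [T₁, T₂]} ½ ‖P_s(x, ·) - P_t(y, ·)‖_var`. -/
noncomputable def extendedDoeblinCoeff (M : StrongMarkovProcess X) (T₁ T₂ : ℝ≥0) (A : Set X) :
    ℝ≥0∞ :=
  ⨆ x ∈ A, ⨆ y ∈ A, ⨆ s ∈ Set.Icc T₁ T₂, ⨆ t ∈ Set.Icc T₁ T₂,
    varDist (M.transition s x) (M.transition t y) / 2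

/-- The Doeblin condition on a set `A`. -/
def DoeblinOn (M : StrongMarkovProcess X) (A : Set X) : Prop :=
  ∃ T : ℝ≥0, 0 < T ∧ M.doeblinCoeff T A < 1

/-- The extended Doeblin condition on a set `A`. -/
def ExtendedDoeblinOn (M : StrongMarkovProcess X) (A : Set X) : Prop :=
  ∃ T₁ T₂ : ℝ≥0, 0 < T₁ ∧ T₁ < T₂ ∧ M.extendedDoeblinCoeff T₁ T₂ A < 1

end StrongMarkovProcess

/-! The proof joins Harris' theorem in weighted total variation to a maximal coupling of whole
trajectories.

Restarting the process at a visit to `K` turns the hitting bound into the Lyapunov estimate `E_x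
φ(X_t) ≤ e^{-αt} φ(x) + C`. The tail condition enters only through `sup E_x φ(X_t) < ∞` over `x ∈
K`, `t ≥ 0`. Since `τ_K` need not be a stopping time of the filtration, it is replaced by a smaller
stopping time at which the path is almost surely in `K`
(`CadlagPath.exists_stoppingTime_le_hittingTime`).

Harris' argument needs overlap of the transition laws on level sets of `φ`. If only the extended
Doeblin condition on `K` is given, two points of a level set reach `K` by a time `L` with
probability at least 1/2 each, but at different times. The resulting lag, at most `L`, is worked off
in pieces of length `T₂ - T₁`: each uses one overlap of `P_s` and `P_t` with `s ≠ t`, then a return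
to `K` from a common point (`exists_tvLe_of_lag`, `exists_tvLe_level`).

Now `P_T` contracts a distance with weight `1 + bφ` (`integral_sub_integral_le_of_harris`). This
gives geometric convergence along multiples of `T` and an invariant `π` as a setwise limit.

For the coupling, put `a_n = P_{nT}(x, ·)` and `c_n = a_n ⊓ π`. The excesses `a_n - c_n` and `π -
c_n` have `φ`-mass of order `γ^n (φ(x) + ∫ φ dπ)`. Because `c_n P_T ≤ c_{n+1}`, the path laws
started from `c_n` form a growing common part of the two shifted path laws.
`exists_successive_coupling` matches the newly common mass at every stage so that the two paths
agree from time `nT` on. If they differ at some `t ≥ nT`, no match occurred up to stage `n`, and the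
excess masses control this event. The matching disintegrates measures on path space, hence the proof
that this space is standard Borel. -/

/-- `μ` and `ν` are at total variation distance at most `κ`, tested on functions into `[0, 1]`. -/
def TVLe {X : Type*} [MeasurableSpace X] (κ : ℝ) (μ ν : Measure X) : Prop :=
  ∀ f : X → ℝ, Measurable f → (∀ x, 0 ≤ f x) → (∀ x, f x ≤ 1) →
    ∫ x, f x ∂μ - ∫ x, f x ∂ν ≤ κ

/-! ### Total variation distance and test functions. -/

section TotalVariation

variable {X : Type*} [MeasurableSpace X]

lemma integrable_of_mem_Icc {μ : Measure X} [IsFiniteMeasure μ] {f : X → ℝ} (hf : Measurable f)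
    {a b : ℝ} (ha : ∀ x, a ≤ f x) (hb : ∀ x, f x ≤ b) : Integrable f μ :=
  Integrable.of_mem_Icc a b hf.aemeasurable (Eventually.of_forall fun x => ⟨ha x, hb x⟩)

lemma restrict_le_restrict_of_forall_subset {μ ν : Measure X} {s : Set X} (hs : MeasurableSet s)
    (h : ∀ t, MeasurableSet t → t ⊆ s → ν t ≤ μ t) : ν.restrict s ≤ μ.restrict s := by
  refine Measure.le_iff.2 fun t ht => ?_
  rw [Measure.restrict_apply ht, Measure.restrict_apply ht]
  exact h _ (ht.inter hs) Set.inter_subset_right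

/-- On a Hahn set `s` raising `f` to 1 increases the difference of integrals, and off `s` lowering
`f` to 0 does, so the extremal test function is the indicator of `s`. -/
lemma tvLe_of_measureReal_sub_le {μ ν : Measure X} [IsFiniteMeasure μ] [IsFiniteMeasure ν]
    {κ : ℝ} (h : ∀ B, MeasurableSet B → μ.real B - ν.real B ≤ κ) : TVLe κ μ ν := by
  intro f hf h0 h1
  obtain ⟨s, hs, hpos, hneg⟩ := hahn_decomposition μ ν
  have hpos := restrict_le_restrict_of_forall_subset hs hpos
  have hneg := restrict_le_restrict_of_forall_subset hs.compl hneg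
  have hint : ∀ (ρ : Measure X) [IsFiniteMeasure ρ], Integrable f ρ := fun ρ _ =>
    integrable_of_mem_Icc hf h0 h1
  have e1 := integral_add_compl hs (hint μ)
  have e2 := integral_add_compl hs (hint ν)
  have l1 : ∫ x in sᶜ, f x ∂μ ≤ ∫ x in sᶜ, f x ∂ν :=
    integral_mono_measure hneg (Eventually.of_forall h0) (hint _)
  have l2 : ∫ x in s, (1 - f x) ∂ν ≤ ∫ x in s, (1 - f x) ∂μ :=
    integral_mono_measure hpos (Eventually.of_forall fun x => sub_nonneg.2 (h1 x))
      ((integrable_const _).sub (hint _))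
  rw [integral_sub (integrable_const _) (hint _), integral_sub (integrable_const _) (hint _)] at l2
  simp only [integral_const, MeasurableSet.univ, measureReal_restrict_apply, Set.univ_inter,
    smul_eq_mul, mul_one] at l2
  have := h s hs
  linarith

lemma TVLe.integral_sub_le {μ ν : Measure X} [IsProbabilityMeasure μ] [IsProbabilityMeasure ν]
    {κ : ℝ} (h : TVLe κ μ ν) {f : X → ℝ} (hf : Measurable f) {a b : ℝ} (hab : a < b)
    (ha : ∀ x, a ≤ f x) (hb : ∀ x, f x ≤ b) :
    ∫ x, f x ∂μ - ∫ x, f x ∂ν ≤ κ * (b - a) := by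
  have hba : 0 < b - a := sub_pos.2 hab
  have := h (fun x => (f x - a) / (b - a)) (by fun_prop)
    (fun x => div_nonneg (sub_nonneg.2 (ha x)) hba.le)
    (fun x => (div_le_one hba).2 (by linarith [hb x]))
  rw [integral_div, integral_div, integral_sub (integrable_of_mem_Icc hf ha hb) (integrable_const _),
    integral_sub (integrable_of_mem_Icc hf ha hb) (integrable_const _)] at this
  simp only [integral_const, probReal_univ, smul_eq_mul, one_mul] at this
  rw [← sub_div, div_le_iff₀ hba] at this
  linarith

/-- For probability measures both Jordan parts have the same mass, so half the variation is the mass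
of the positive part. -/
lemma ofReal_measureReal_sub_le_varDist (μ ν : Measure X) [IsProbabilityMeasure μ]
    [IsProbabilityMeasure ν] {B : Set X} (hB : MeasurableSet B) :
    ENNReal.ofReal (μ.real B - ν.real B) ≤ varDist μ ν / 2 := by
  set s := μ.toSignedMeasure - ν.toSignedMeasure with hs
  have key : ∀ A, MeasurableSet A → μ.real A - ν.real A =
      s.toJordanDecomposition.posPart.real A - s.toJordanDecomposition.negPart.real A := by
    intro A hA
    rw [← s.apply_eq_posPart_real_sub_negPart_real hA, hs]
    simp [Measure.toSignedMeasure_apply_measurable hA]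
  have huniv := key Set.univ MeasurableSet.univ
  simp only [probReal_univ, sub_self] at huniv
  have hB' : μ.real B - ν.real B ≤ s.toJordanDecomposition.posPart.real Set.univ := by
    rw [key B hB]
    have h1 : s.toJordanDecomposition.posPart.real B ≤
      s.toJordanDecomposition.posPart.real Set.univ := measureReal_mono (Set.subset_univ B)
    have h2 : 0 ≤ s.toJordanDecomposition.negPart.real B := measureReal_nonneg
    linarith
  have e : varDist μ ν = 2 * ENNReal.ofReal (s.toJordanDecomposition.posPart.real Set.univ) := by
    have : varDist μ ν = s.toJordanDecomposition.posPart Set.univ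
      + s.toJordanDecomposition.negPart Set.univ := rfl
    rw [this, two_mul]
    congr 1
    · rw [ofReal_measureReal]
    · rw [sub_eq_zero.1 huniv.symm, ofReal_measureReal]
  rw [e, mul_comm, ENNReal.mul_div_cancel_right (by simp) (by simp)]
  exact ENNReal.ofReal_le_ofReal hB'

lemma tvLe_of_varDist_le {μ ν : Measure X} [IsProbabilityMeasure μ]
    [IsProbabilityMeasure ν] {κ : ℝ≥0∞} (hκ : κ ≠ ∞) (h : varDist μ ν / 2 ≤ κ) :
    TVLe κ.toReal μ ν := by
  refine tvLe_of_measureReal_sub_le fun B hB => ?_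
  have := (ofReal_measureReal_sub_le_varDist μ ν hB).trans h
  exact (ENNReal.ofReal_le_iff_le_toReal hκ).1 this

end TotalVariation

/-- The given metric may be incomplete, but the space is open in its completion: the image of a
compact neighbourhood is closed there, so by density it contains a whole open set. -/
lemma polishSpace_of_locallyCompactSpace (X : Type*) [MetricSpace X] [LocallyCompactSpace X]
    [SecondCountableTopology X] : PolishSpace X := by
  have hemb : IsEmbedding ((↑) : X → UniformSpace.Completion X) :=
    UniformSpace.Completion.coe_isometry.isEmbedding
  have hdense : DenseRange ((↑) : X → UniformSpace.Completion X) :=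
    UniformSpace.Completion.denseRange_coe
  have : TopologicalSpace.SeparableSpace (UniformSpace.Completion X) :=
    hdense.separableSpace hemb.continuous
  have : SecondCountableTopology (UniformSpace.Completion X) :=
    UniformSpace.secondCountable_of_separable _
  have hopen : IsOpen (Set.range ((↑) : X → UniformSpace.Completion X)) := by
    refine isOpen_iff_mem_nhds.2 ?_
    rintro _ ⟨x, rfl⟩
    obtain ⟨C, hC, hxC⟩ := exists_compact_mem_nhds x
    rw [hemb.nhds_eq_comap, mem_comap] at hxC
    obtain ⟨V, hV, hVC⟩ := hxC
    obtain ⟨W, hWV, hW, hxW⟩ := mem_nhds_iff.1 hV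
    refine mem_of_superset (hW.mem_nhds hxW) ?_
    have h1 : W ⊆ closure (W ∩ Set.range ((↑) : X → UniformSpace.Completion X)) :=
      hdense.open_subset_closure_inter hW
    have h2 : closure (W ∩ Set.range ((↑) : X → UniformSpace.Completion X)) ⊆ (↑) '' C := by
      refine closure_minimal ?_ (hC.image hemb.continuous).isClosed
      rintro _ ⟨hy, y, rfl⟩
      exact ⟨y, hVC (hWV hy), rfl⟩
    exact (h1.trans h2).trans (Set.image_subset_range _ _)
  have := hopen.polishSpace
  exact hemb.toHomeomorph.isClosedEmbedding.polishSpace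

namespace CadlagPath

/-! ### Joint measurability of evaluation and shift. -/

section Measurability

variable {X : Type u} [TopologicalSpace X]

lemma eval_shift (r s : ℝ≥0) (ω : CadlagPath X) : (shift r ω).eval s = ω.eval (r + s) := rfl

lemma shift_shift (r s : ℝ≥0) (ω : CadlagPath X) : shift r (shift s ω) = shift (s + r) ω := by
  refine Subtype.ext (funext fun t => ?_)
  change ω.1 (s + (r + t)) = ω.1 (s + r + t)
  rw [add_assoc]

variable [MeasurableSpace X]

lemma measurable_iff_eval {Y : Type*} [MeasurableSpace Y] {F : Y → CadlagPath X} :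
    Measurable F ↔ ∀ t, Measurable fun y => (F y).eval t := by
  refine ⟨fun h t => (measurable_eval t).comp h, fun h => ?_⟩
  exact Measurable.subtype_mk (measurable_pi_lambda _ h)

lemma measurable_shift (r : ℝ≥0) : Measurable (shift r : CadlagPath X → CadlagPath X) :=
  measurable_iff_eval.2 fun t => measurable_eval (r + t)

variable [TopologicalSpace.PseudoMetrizableSpace X] [BorelSpace X]

lemma measurable_eval_prod : Measurable fun p : ℝ≥0 × CadlagPath X => p.2.eval p.1 := by
  -- Grid times above `t`: they take countably many values and converge to `t` from the right, where
  -- paths are continuous.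
  let T : ℕ → ℝ≥0 → ℝ≥0 := fun n t => (⌊t * (n + 1)⌋₊ + 1 : ℝ≥0) / (n + 1)
  have hT : ∀ t, Tendsto (fun n => T n t) atTop (𝓝[≥] t) := by
    intro t
    have hle : ∀ n, t ≤ T n t := fun n => by
      rw [le_div_iff₀ (by positivity)]
      exact (Nat.lt_floor_add_one _).le
    have hge : ∀ n : ℕ, T n t ≤ t + 1 / (n + 1) := fun n => by
      rw [div_le_iff₀ (by positivity), add_mul, one_div, inv_mul_cancel₀ (by positivity)]
      gcongr
      exact Nat.floor_le (by positivity)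
    refine tendsto_nhdsWithin_iff.2 ⟨?_, Eventually.of_forall hle⟩
    refine tendsto_of_tendsto_of_tendsto_of_le_of_le tendsto_const_nhds ?_ hle hge
    have : Tendsto (fun n : ℕ => t + 1 / ((n : ℝ≥0) + 1)) atTop (𝓝 (t + 0)) :=
      tendsto_const_nhds.add tendsto_one_div_add_atTop_nhds_zero_nat
    simpa using this
  refine measurable_of_tendsto_metrizable (f := fun n (p : ℝ≥0 × CadlagPath X) =>
    p.2.eval (T n p.1)) (fun n => ?_) (tendsto_pi_nhds.2 fun p => ?_)
  · have h : Measurable fun p : ℕ × CadlagPath X =>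
        p.2.eval ((p.1 + 1 : ℝ≥0) / (n + 1)) :=
      measurable_from_prod_countable_right fun k => measurable_eval ((k + 1 : ℝ≥0) / (n + 1))
    have hfl : Measurable fun p : ℝ≥0 × CadlagPath X => (⌊p.1 * (n + 1)⌋₊, p.2) := by
      refine Measurable.prodMk ?_ measurable_snd
      exact Nat.measurable_floor.comp (measurable_fst.mul_const _)
    exact h.comp hfl
  · exact ((p.2.2 p.1).1.tendsto).comp (hT p.1)

lemma measurable_shift_prod : Measurable fun p : ℝ≥0 × CadlagPath X => shift p.1 p.2 :=
  measurable_iff_eval.2 fun t =>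
    measurable_eval_prod.comp ((measurable_fst.add_const t).prodMk measurable_snd)

end Measurability

end CadlagPath

lemma StandardBorelSpace.of_measurableEquiv {α β : Type*} [MeasurableSpace α] [MeasurableSpace β]
    [StandardBorelSpace β] (e : α ≃ᵐ β) : StandardBorelSpace α := by
  let := upgradeStandardBorel β
  let τ : TopologicalSpace α := TopologicalSpace.induced e inferInstance
  have h := e.measurableEmbedding.comap_eq.symm.trans
    ((congrArg (MeasurableSpace.comap e) BorelSpace.measurable_eq).trans borel_comap.symm)
  exact ⟨τ, ⟨h⟩, e.toEquiv.polishSpace_induced⟩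

namespace CadlagPath

/-! ### The path space is standard Borel. -/

section Regular

variable {X : Type u} [MetricSpace X] {D : Set ℝ≥0}

/-- The countably many conditions under which a function on a countable dense set of times extends
to a càdlàg trajectory: right-continuity along the set, and a bound on the number of oscillations
of a given size before a given time. -/
def IsRegular (f : D → X) : Prop :=
  (∀ q : D, ∀ k : ℕ, ∃ m : ℕ, ∀ q' : D, (q : ℝ≥0) < q' → (q' : ℝ≥0) < q + 1 / (m + 1) →
    dist (f q') (f q) ≤ 1 / (k + 1)) ∧
  ∀ N k : ℕ, ∃ n : ℕ, ∀ q : Fin (n + 1) → D, (StrictMono q ∨ StrictAnti q) →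
    (∀ i, (q i : ℝ≥0) ≤ N) →
      ∃ i : Fin n, dist (f (q i.castSucc)) (f (q i.succ)) ≤ 1 / (k + 1)

/-- Otherwise every time in `P` has a successor in `P` across which `f` moves by more than
`1/(k+1)`. Iterating produces monotone chains of any length, against the bound on oscillations. Both
directions are needed, for limits from the left and from the right. -/
lemma IsRegular.exists_forall_dist_le {f : D → X} (hf : IsRegular f) {N : ℕ} (k : ℕ) {P : Set D}
    (hP : P.Nonempty) (hN : ∀ q ∈ P, (q : ℝ≥0) ≤ N) {r : D → D → Prop}
    (hr : (∀ a b, r a b ↔ a < b) ∨ (∀ a b, r a b ↔ b < a)) :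
    ∃ q ∈ P, ∀ q' ∈ P, r q q' → dist (f q) (f q') ≤ 1 / (k + 1) := by
  by_contra! hcon
  choose! next hnext using hcon
  obtain ⟨q0, hq0⟩ := hP
  let s : ℕ → D := fun n => next^[n] q0
  have hs_succ : ∀ n, s (n + 1) = next (s n) := fun n => Function.iterate_succ_apply' _ _ _
  have hsP : ∀ n, s n ∈ P := by
    intro n
    induction n with
    | zero => exact hq0
    | succ n ih => rw [hs_succ]; exact (hnext _ ih).1
  obtain ⟨n, hn⟩ := hf.2 N k
  obtain ⟨i, hi⟩ := hn (fun i => s i) (by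
    rcases hr with hr | hr
    · left
      have : StrictMono s := strictMono_nat_of_lt_succ fun n => by
        rw [hs_succ]; exact (hr _ _).1 (hnext _ (hsP n)).2.1
      exact fun a b hab => this hab
    · right
      have : StrictAnti s := strictAnti_nat_of_succ_lt fun n => by
        rw [hs_succ]; exact (hr _ _).1 (hnext _ (hsP n)).2.1
      exact fun a b hab => this hab) (fun i => hN _ (hsP _))
  have := (hnext _ (hsP i)).2.2
  rw [← hs_succ] at this
  simp only [Fin.val_castSucc, Fin.val_succ] at hi
  exact absurd hi (not_le.2 this)

lemma isRegular_restrict (ω : CadlagPath X) : IsRegular (fun q : D => ω.eval q) := by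
  refine ⟨fun q k => ?_, fun N k => ?_⟩
  · have h := Metric.tendsto_nhds.1 (ω.2 q).1.tendsto (1 / ((k : ℝ) + 1)) (by positivity)
    obtain ⟨u, hu, hu'⟩ := (mem_nhdsGE_iff_exists_Ico_subset' (lt_add_one (q : ℝ≥0))).1 h
    obtain ⟨m, hm⟩ := exists_nat_one_div_lt (tsub_pos_of_lt (Set.mem_Ioi.1 hu))
    refine ⟨m, fun q' h1 h2 => (hu' ⟨h1.le, h2.trans ?_⟩).le⟩
    exact lt_tsub_iff_left.1 hm
  -- Around each `t` the path oscillates by at most `1/(k+1)` on either side of `t` separately; a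
  -- jump at `t` itself is allowed.
  · have hloc : ∀ t : ℝ≥0, ∃ δ > (0 : ℝ), ∀ s ∈ Metric.ball t δ, ∀ s' ∈ Metric.ball t δ,
        (s < t ↔ s' < t) → dist (ω.1 s) (ω.1 s') ≤ 1 / (k + 1) := by
      intro t
      have hk : (0 : ℝ) < 1 / ((k : ℝ) + 1) / 2 := by positivity
      have h1 := Metric.tendsto_nhds.1 (ω.2 t).1.tendsto _ hk
      obtain ⟨l, hl⟩ := (ω.2 t).2
      have h2 := Metric.tendsto_nhds.1 hl _ hk
      rw [eventually_nhdsWithin_iff] at h1 h2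
      obtain ⟨δ, hδ, hball⟩ := Metric.eventually_nhds_iff_ball.1 (h1.and h2)
      refine ⟨δ, hδ, fun s hs s' hs' hiff => ?_⟩
      by_cases hst : s < t
      · have a := (hball s hs).2 hst
        have b := (hball s' hs').2 (hiff.1 hst)
        linarith [dist_triangle_right (ω.1 s) (ω.1 s') l]
      · have a := (hball s hs).1 (not_lt.1 hst)
        have b := (hball s' hs').1 (not_lt.1 fun h => hst (hiff.2 h))
        linarith [dist_triangle_right (ω.1 s) (ω.1 s') (ω.1 t)]
    choose δ hδ hosc using hloc
    obtain ⟨T, -, hT⟩ := (isCompact_Icc (a := (0 : ℝ≥0)) (b := N)).elim_nhds_subcover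
      (fun t => Metric.ball t (δ t)) (fun t _ => Metric.ball_mem_nhds t (hδ t))
    -- Pigeonhole over half-balls: there is one more point than there are pairs (ball, side), so two
    -- points share a half-ball. It is an interval, so it also contains the immediate successor of
    -- the first point.
    refine ⟨Fintype.card (T × Bool), fun q hq hqN => ?_⟩
    have hpiece : ∀ i, ∃ t : T, (q i : ℝ≥0) ∈ Metric.ball (t : ℝ≥0) (δ t) := fun i => by
      have := hT (⟨zero_le, hqN i⟩ : (q i : ℝ≥0) ∈ Set.Icc 0 (N : ℝ≥0))
      simp only [Set.mem_iUnion] at this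
      obtain ⟨t, ht, h⟩ := this
      exact ⟨⟨t, ht⟩, h⟩
    choose c hc using hpiece
    obtain ⟨i, j, hij, heq⟩ := Fintype.exists_ne_map_eq_of_card_lt
      (fun i => (c i, decide ((q i : ℝ≥0) < c i))) (by simp)
    wlog hlt : i < j generalizing i j
    · exact this j i hij.symm heq.symm (lt_of_le_of_ne (not_lt.1 hlt) hij.symm)
    obtain ⟨heq1, heq2⟩ := Prod.ext_iff.1 heq
    simp only at heq1 heq2
    have hi : (i : ℕ) < Fintype.card (T × Bool) := by have := j.2; omega
    refine ⟨⟨i, hi⟩, ?_⟩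
    have e1 : (⟨i, hi⟩ : Fin (Fintype.card (T × Bool))).castSucc = i := rfl
    set i' := (⟨i, hi⟩ : Fin (Fintype.card (T × Bool))).succ with hi'
    have l1 : i ≤ i' := by rw [Fin.le_def, hi']; simp
    have l2 : i' ≤ j := by rw [Fin.le_def, hi']; simpa using hlt
    rw [e1]
    have hbet : ((q i : ℝ≥0) ≤ q i' ∧ (q i' : ℝ≥0) ≤ q j) ∨
        ((q j : ℝ≥0) ≤ q i' ∧ (q i' : ℝ≥0) ≤ q i) := by
      rcases hq with hq | hq
      · exact Or.inl ⟨hq.monotone l1, hq.monotone l2⟩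
      · exact Or.inr ⟨hq.antitone l2, hq.antitone l1⟩
    have b1 := hc i
    have b2 := hc j
    rw [← heq1] at b2 heq2
    refine hosc (c i) _ b1 _ ?_ ?_
    · rw [Metric.mem_ball, NNReal.dist_eq, abs_lt] at b1 b2 ⊢
      rcases hbet with h | h
      · have h1 : ((q i : ℝ≥0) : ℝ) ≤ (q i' : ℝ≥0) := NNReal.coe_le_coe.2 h.1
        have h2 : ((q i' : ℝ≥0) : ℝ) ≤ (q j : ℝ≥0) := NNReal.coe_le_coe.2 h.2
        constructor <;> linarith [b1.1, b1.2, b2.1, b2.2]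
      · have h1 : ((q i' : ℝ≥0) : ℝ) ≤ (q i : ℝ≥0) := NNReal.coe_le_coe.2 h.2
        have h2 : ((q j : ℝ≥0) : ℝ) ≤ (q i' : ℝ≥0) := NNReal.coe_le_coe.2 h.1
        constructor <;> linarith [b1.1, b1.2, b2.1, b2.2]
    · have hd : (q i : ℝ≥0) < c i ↔ (q j : ℝ≥0) < c i := decide_eq_decide.1 heq2
      rcases hbet with h | h
      · exact ⟨fun hh => lt_of_le_of_lt h.2 (hd.1 hh), fun hh => lt_of_le_of_lt h.1 hh⟩
      · exact ⟨fun hh => lt_of_le_of_lt h.2 hh, fun hh => hd.2 (lt_of_le_of_lt h.1 hh)⟩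

lemma comap_nhdsGT_neBot (hD : Dense D) (t : ℝ≥0) :
    (comap ((↑) : D → ℝ≥0) (𝓝[>] t)).NeBot := by
  refine comap_neBot fun s hs => ?_
  obtain ⟨u, hu, hus⟩ := (mem_nhdsGT_iff_exists_Ioo_subset' (lt_add_one t)).1 hs
  obtain ⟨q, hq, hqm⟩ := hD.exists_between hu
  exact ⟨⟨q, hq⟩, hus hqm⟩

lemma IsRegular.exists_tendsto_nhdsGT [CompleteSpace X] (hD : Dense D) {f : D → X}
    (hf : IsRegular f) (t : ℝ≥0) :
    ∃ l, Tendsto f (comap ((↑) : D → ℝ≥0) (𝓝[>] t)) (𝓝 l) := by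
  have := comap_nhdsGT_neBot hD t
  refine cauchy_map_iff_exists_tendsto.1 (Metric.cauchy_iff.2 ⟨inferInstance, fun ε hε => ?_⟩)
  obtain ⟨k, hk⟩ := exists_nat_one_div_lt (half_pos hε)
  obtain ⟨N, hN⟩ := exists_nat_ge (t + 1)
  obtain ⟨q, hq, hqm⟩ := hD.exists_between (lt_add_one t)
  obtain ⟨q0, hq0, h⟩ := hf.exists_forall_dist_le (N := N) k
    (P := {q | t < (q : ℝ≥0) ∧ (q : ℝ≥0) < t + 1}) ⟨⟨q, hq⟩, hqm⟩
    (fun q hq => hq.2.le.trans hN) (r := fun a b => b < a) (Or.inr fun _ _ => Iff.rfl)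
  refine ⟨f '' {q | t < (q : ℝ≥0) ∧ (q : ℝ≥0) < q0}, image_mem_map
    ⟨Set.Ioo t q0, Ioo_mem_nhdsGT hq0.1, fun q hq => hq⟩, ?_⟩
  rintro _ ⟨a, ha, rfl⟩ _ ⟨b, hb, rfl⟩
  have h1 := h a ⟨ha.1, ha.2.trans hq0.2⟩ ha.2
  have h2 := h b ⟨hb.1, hb.2.trans hq0.2⟩ hb.2
  linarith [dist_triangle_left (f a) (f b) (f q0)]

lemma IsRegular.exists_tendsto_nhdsLT [CompleteSpace X] (hD : Dense D) {f : D → X}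
    (hf : IsRegular f) {t : ℝ≥0} (ht : 0 < t) :
    ∃ l, Tendsto f (comap ((↑) : D → ℝ≥0) (𝓝[<] t)) (𝓝 l) := by
  have : (comap ((↑) : D → ℝ≥0) (𝓝[<] t)).NeBot := by
    refine comap_neBot fun s hs => ?_
    obtain ⟨u, hu, hus⟩ := (mem_nhdsLT_iff_exists_Ioo_subset' ht).1 hs
    obtain ⟨q, hq, hqm⟩ := hD.exists_between hu
    exact ⟨⟨q, hq⟩, hus hqm⟩
  refine cauchy_map_iff_exists_tendsto.1 (Metric.cauchy_iff.2 ⟨inferInstance, fun ε hε => ?_⟩)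
  obtain ⟨k, hk⟩ := exists_nat_one_div_lt (half_pos hε)
  obtain ⟨N, hN⟩ := exists_nat_ge t
  obtain ⟨q, hq, hqm⟩ := hD.exists_between ht
  obtain ⟨q0, hq0, h⟩ := hf.exists_forall_dist_le (N := N) k
    (P := {q | (q : ℝ≥0) < t}) ⟨⟨q, hq⟩, hqm.2⟩
    (fun q hq => (le_of_lt hq).trans hN) (r := fun a b => a < b) (Or.inl fun _ _ => Iff.rfl)
  refine ⟨f '' {q | (q0 : ℝ≥0) < (q : ℝ≥0) ∧ (q : ℝ≥0) < t}, image_mem_map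
    ⟨Set.Ioo (q0 : ℝ≥0) t, Ioo_mem_nhdsLT hq0, fun q hq => hq⟩, ?_⟩
  rintro _ ⟨a, ha, rfl⟩ _ ⟨b, hb, rfl⟩
  have h1 := h a ha.2 ha.1
  have h2 := h b hb.2 hb.1
  linarith [dist_triangle_left (f a) (f b) (f q0)]

/-- The extension is the right limit along `D`. Closed neighbourhoods survive limits, which gives
its one-sided limits; the first regularity condition makes it agree with `f` on `D`. -/
lemma IsRegular.exists_extension [CompleteSpace X] (hD : Dense D) {f : D → X}
    (hf : IsRegular f) : ∃ ω : CadlagPath X, (fun q : D => ω.eval q) = f := by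
  choose g hg using hf.exists_tendsto_nhdsGT hD
  have hlim : ∀ {a b : ℝ≥0} {C : Set X}, IsClosed C →
      (∀ q : D, (q : ℝ≥0) ∈ Set.Ioo a b → f q ∈ C) → ∀ s ∈ Set.Ioo a b, g s ∈ C := by
    intro a b C hC h s hs
    have := comap_nhdsGT_neBot hD s
    refine hC.mem_of_tendsto (hg s) ⟨Set.Ioo s b, Ioo_mem_nhdsGT hs.2, fun q hq => ?_⟩
    exact h q ⟨hs.1.trans hq.1, hq.2⟩
  have hright : ∀ t, Tendsto g (𝓝[>] t) (𝓝 (g t)) := by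
    intro t
    refine (closed_nhds_basis (g t)).tendsto_right_iff.2 fun C hC => ?_
    obtain ⟨s, hs, hsub⟩ := mem_comap.1 (hg t hC.1)
    obtain ⟨u, hu, hus⟩ := (mem_nhdsGT_iff_exists_Ioo_subset' (lt_add_one t)).1 hs
    exact mem_of_superset (Ioo_mem_nhdsGT hu)
      (hlim hC.2 fun q hq => hsub (Set.mem_preimage.2 (hus hq)))
  have hleft : ∀ t, ∃ l, Tendsto g (𝓝[<] t) (𝓝 l) := by
    intro t
    rcases eq_or_lt_of_le (zero_le (a := t)) with rfl | ht
    · have : 𝓝[<] (0 : ℝ≥0) = ⊥ := by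
        rw [show Set.Iio (0 : ℝ≥0) = ∅ by ext; simp, nhdsWithin_empty]
      exact ⟨g 0, by rw [this]; exact tendsto_bot⟩
    · obtain ⟨l, hl⟩ := hf.exists_tendsto_nhdsLT hD ht
      refine ⟨l, (closed_nhds_basis l).tendsto_right_iff.2 fun C hC => ?_⟩
      obtain ⟨s, hs, hsub⟩ := mem_comap.1 (hl hC.1)
      obtain ⟨u, hu, hus⟩ := (mem_nhdsLT_iff_exists_Ioo_subset' ht).1 hs
      exact mem_of_superset (Ioo_mem_nhdsLT hu)
        (hlim hC.2 fun q hq => hsub (Set.mem_preimage.2 (hus hq)))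
  refine ⟨⟨g, fun t => ⟨continuousWithinAt_Ioi_iff_Ici.1 (hright t), hleft t⟩⟩, ?_⟩
  funext q
  have := comap_nhdsGT_neBot hD (q : ℝ≥0)
  refine tendsto_nhds_unique (hg q) (Metric.tendsto_nhds.2 fun ε hε => ?_)
  obtain ⟨k, hk⟩ := exists_nat_one_div_lt hε
  obtain ⟨m, hm⟩ := hf.1 q k
  refine ⟨Set.Ioo (q : ℝ≥0) (q + 1 / (m + 1)), Ioo_mem_nhdsGT (lt_add_of_pos_right _ (by positivity)),
    fun q' hq' => (hm q' hq'.1 hq'.2).trans_lt hk⟩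

lemma measurableSet_isRegular [MeasurableSpace X] [BorelSpace X] [SecondCountableTopology X]
    [Countable D] : MeasurableSet {f : D → X | IsRegular f} := by
  have hd : ∀ (a b : D) (c : ℝ), MeasurableSet {f : D → X | dist (f a) (f b) ≤ c} := fun a b c =>
    measurableSet_le ((measurable_pi_apply a).dist (measurable_pi_apply b)) measurable_const
  simp only [IsRegular, Set.ofPred_and, Set.ofPred_forall, Set.ofPred_exists]
  refine MeasurableSet.inter ?_ ?_
  · exact .iInter fun q => .iInter fun k => .iUnion fun m => .iInter fun q' => .iInter fun _ =>
      .iInter fun _ => hd _ _ _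
  · exact .iInter fun N => .iInter fun k => .iUnion fun n => .iInter fun q => .iInter fun _ =>
      .iInter fun _ => .iUnion fun i => hd _ _ _

end Regular

/-- Restriction to a countable dense set of times embeds the path space in `D → X` with measurable
range, the regular functions. The inverse is measurable because each position is a right limit along
`D`. -/
lemma standardBorelSpace_of_completeSpace (X : Type u) [MetricSpace X] [CompleteSpace X]
    [SecondCountableTopology X] [MeasurableSpace X] [BorelSpace X] :
    StandardBorelSpace (CadlagPath X) := by
  obtain ⟨D, hDc, hD⟩ := TopologicalSpace.exists_countable_dense ℝ≥0
  have : Countable D := hDc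
  let F : CadlagPath X → (D → X) := fun ω q => ω.eval q
  have hF : Measurable F := measurable_pi_lambda _ fun q => measurable_eval _
  have hrange : Set.range F = {f | IsRegular f} := by
    ext f
    exact ⟨by rintro ⟨ω, rfl⟩; exact isRegular_restrict ω, fun h => h.exists_extension hD⟩
  have hlim : ∀ (ω : CadlagPath X) (t : ℝ≥0), Tendsto (F ω) (comap ((↑) : D → ℝ≥0) (𝓝[>] t))
      (𝓝 (ω.eval t)) := fun ω t =>
    ((ω.2 t).1.tendsto.mono_left (nhdsWithin_mono _ Set.Ioi_subset_Ici_self)).comp tendsto_comap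
  have hinj : Function.Injective F := by
    intro ω ω' h
    refine Subtype.ext (funext fun t => ?_)
    have := comap_nhdsGT_neBot hD t
    exact tendsto_nhds_unique (hlim ω t) (h ▸ hlim ω' t)
  have hS : MeasurableSet (Set.range F) := hrange ▸ measurableSet_isRegular
  let e : CadlagPath X ≃ Set.range F := Equiv.ofInjective F hinj
  have hesymm : Measurable e.symm := by
    refine measurable_iff_eval.2 fun t => ?_
    have := comap_nhdsGT_neBot hD t
    refine measurable_of_tendsto_metrizable' (comap ((↑) : D → ℝ≥0) (𝓝[>] t))
      (f := fun (q : D) (p : Set.range F) => p.1 q)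
      (fun q => (measurable_pi_apply q).comp measurable_subtype_coe) ?_
    refine tendsto_pi_nhds.2 fun p => ?_
    have hp : F (e.symm p) = p.1 := congrArg Subtype.val (e.apply_symm_apply p)
    have := hlim (e.symm p) t
    rw [hp] at this
    exact this
  have := hS.standardBorel
  exact StandardBorelSpace.of_measurableEquiv (MeasurableEquiv.mk e hF.subtype_mk hesymm)

/-- Càdlàg paths depend only on the topology, so a complete metric may be chosen freely. -/
lemma standardBorelSpace (X : Type u) [TopologicalSpace X] [PolishSpace X] [MeasurableSpace X]
    [BorelSpace X] : StandardBorelSpace (CadlagPath X) := by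
  let := TopologicalSpace.upgradeIsCompletelyMetrizable X
  exact standardBorelSpace_of_completeSpace X

end CadlagPath

namespace CadlagPath

/-! ### A stopping time that replaces the hitting time of a closed set. -/

section EntranceTime

variable {X : Type u}

/-- The first time after `τ` at which the trajectory enters `U`. -/
noncomputable def entranceAfter [TopologicalSpace X] (τ : CadlagPath X → WithTop ℝ≥0) (U : Set X)
    (ω : CadlagPath X) : WithTop ℝ≥0 :=
  if τ ω = ⊤ then ⊤ else hittingAfter eval U ((τ ω).untopD 0) ω

lemma entranceAfter_lt_iff [TopologicalSpace X] {τ : CadlagPath X → WithTop ℝ≥0} {U : Set X}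
    {ω : CadlagPath X} {i : ℝ≥0} :
    entranceAfter τ U ω < i ↔ ∃ j : ℝ≥0, τ ω ≤ j ∧ j < i ∧ ω.eval j ∈ U := by
  unfold entranceAfter
  split_ifs with h
  · rw [h]
    exact ⟨fun hlt => absurd hlt not_top_lt,
      fun ⟨j, hj, _⟩ => absurd (top_le_iff.1 hj) WithTop.coe_ne_top⟩
  · lift τ ω to ℝ≥0 using h with s hs
    rw [hittingAfter_lt_iff]
    simp only [WithTop.untopD_coe, Set.mem_Ico, WithTop.coe_le_coe]
    exact ⟨fun ⟨j, ⟨a, b⟩, c⟩ => ⟨j, a, b, c⟩, fun ⟨j, a, b, c⟩ => ⟨j, ⟨a, b⟩, c⟩⟩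

lemma le_entranceAfter [TopologicalSpace X] {τ : CadlagPath X → WithTop ℝ≥0} {U : Set X}
    (ω : CadlagPath X) : τ ω ≤ entranceAfter τ U ω := by
  unfold entranceAfter
  split_ifs with h
  · exact le_top
  · lift τ ω to ℝ≥0 using h with s hs
    exact le_hittingAfter ω

lemma exists_countable_dense_eval_mem [TopologicalSpace X] {D : Set ℝ≥0} (hD : Dense D) {U : Set X}
    (hU : IsOpen U) {ω : CadlagPath X} {i j : ℝ≥0} (hji : j < i) (hj : ω.eval j ∈ U) :
    ∃ q ∈ D, j ≤ q ∧ q < i ∧ ω.eval q ∈ U := by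
  have h := (ω.2 j).1.tendsto (hU.mem_nhds hj)
  obtain ⟨u, hu, hus⟩ := (mem_nhdsGE_iff_exists_Ico_subset' hji).1 h
  obtain ⟨q, hq, hjq, hqu⟩ := hD.exists_between (lt_min hu hji)
  exact ⟨q, hq, hjq.le, hqu.trans_le (min_le_right _ _),
    hus ⟨hjq.le, hqu.trans_le (min_le_left _ _)⟩⟩

lemma isStoppingTime_entranceAfter [TopologicalSpace X] [MeasurableSpace X]
    [OpensMeasurableSpace X] {τ : CadlagPath X → WithTop ℝ≥0}
    (hτ : IsStoppingTime (naturalFiltration X).rightCont τ) {U : Set X} (hU : IsOpen U) :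
    IsStoppingTime (naturalFiltration X).rightCont (entranceAfter τ U) := by
  obtain ⟨D, hDc, hD⟩ := TopologicalSpace.exists_countable_dense ℝ≥0
  refine isStoppingTime_of_measurableSet_lt_of_isRightContinuous fun i => ?_
  have : {ω : CadlagPath X | entranceAfter τ U ω < i} =
      ⋃ q ∈ D ∩ Set.Iio i, {ω | τ ω ≤ q} ∩ {ω | ω.eval q ∈ U} := by
    ext ω
    simp only [Set.mem_ofPred_eq, entranceAfter_lt_iff, Set.mem_iUnion, Set.mem_inter_iff]
    constructor
    · rintro ⟨j, hτj, hji, hj⟩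
      obtain ⟨q, hq, hjq, hqi, hqU⟩ := exists_countable_dense_eval_mem hD hU hji hj
      exact ⟨q, ⟨hq, hqi⟩, hτj.trans (WithTop.coe_le_coe.2 hjq), hqU⟩
    · rintro ⟨q, ⟨-, hqi⟩, hτq, hqU⟩
      exact ⟨q, hτq, hqi, hqU⟩
  rw [this]
  refine MeasurableSet.biUnion (hDc.mono Set.inter_subset_left) fun q hq => ?_
  have hqi : q ≤ i := le_of_lt hq.2
  refine ((naturalFiltration X).rightCont.mono hqi _ (hτ q)).inter
    ((naturalFiltration X).rightCont.mono hqi _ ((naturalFiltration X).le_rightCont q _ ?_))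
  have : MeasurableSpace.comap (eval q) inferInstance ≤ naturalFiltration X q :=
    le_iSup₂_of_le (f := fun s (_ : s ≤ q) => MeasurableSpace.comap (eval s) inferInstance)
      q le_rfl le_rfl
  exact this _ ⟨U, hU.measurableSet, rfl⟩

/-- Although the hitting time of a closed set need not be a stopping time of the right-continuous
natural filtration, there is for each law a stopping time below it that is almost surely a time of
visit to the set. -/
lemma exists_stoppingTime_le_hittingTime [MetricSpace X] [MeasurableSpace X] [BorelSpace X]
    (P : Measure (CadlagPath X)) [IsFiniteMeasure P] {K : Set X} (hK : IsClosed K) :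
    ∃ τ : CadlagPath X → WithTop ℝ≥0, IsStoppingTime (naturalFiltration X).rightCont τ ∧
      (∀ ω, τ ω ≤ StrongMarkovProcess.hittingTime K ω) ∧
      ∀ᵐ ω ∂P, τ ω ≠ ⊤ → ω.eval ((τ ω).untopD 0) ∈ K := by
  let 𝓣 : Set (CadlagPath X → WithTop ℝ≥0) :=
    {τ | IsStoppingTime (naturalFiltration X).rightCont τ ∧
      ∀ ω, τ ω ≤ StrongMarkovProcess.hittingTime K ω}
  let c : WithTop ℝ≥0 → ℝ≥0∞ := fun a => a
  -- A bounded strictly decreasing transform: minimising the integral of `g ∘ τ` over `𝓣` selects an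
  -- essentially largest stopping time, infinite values included.
  let g : WithTop ℝ≥0 → ℝ≥0∞ := fun a => (1 + c a)⁻¹
  have hg : StrictAnti g := fun a b hab =>
    ENNReal.inv_lt_inv.2 (ENNReal.add_lt_add_left ENNReal.one_ne_top hab)
  have hgm : Measurable g := hg.antitone.measurable
  have hg1 : ∀ a, g a ≤ 1 := fun a => ENNReal.inv_le_one.2 le_self_add
  let J : (CadlagPath X → WithTop ℝ≥0) → ℝ≥0∞ := fun τ => ∫⁻ ω, g (τ ω) ∂P
  have hJ : ∀ τ, J τ ≠ ∞ := fun τ =>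
    ((lintegral_mono fun ω => hg1 (τ ω)).trans_lt (by simp)).ne
  have h0 : (fun _ => ((0 : ℝ≥0) : WithTop ℝ≥0)) ∈ 𝓣 :=
    ⟨isStoppingTime_const _ 0, fun ω => bot_le⟩
  obtain ⟨u, -, hu, hu'⟩ := exists_seq_tendsto_sInf (S := J '' 𝓣) ⟨_, _, h0, rfl⟩ (OrderBot.bddBelow _)
  choose s hs hsu using hu'
  let σ : CadlagPath X → WithTop ℝ≥0 := fun ω => ⨆ n, s n ω
  have hσ : σ ∈ 𝓣 := by
    refine ⟨fun i => ?_, fun ω => iSup_le fun n => (hs n).2 ω⟩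
    have : {ω | σ ω ≤ i} = ⋂ n, {ω | s n ω ≤ i} := by
      ext ω
      rw [Set.mem_iInter]
      change (⨆ n, s n ω) ≤ (i : WithTop ℝ≥0) ↔ ∀ n, s n ω ≤ i
      exact iSup_le_iff
    rw [this]
    exact MeasurableSet.iInter fun n => (hs n).1 i
  have hmin : ∀ τ ∈ 𝓣, J σ ≤ J τ := by
    intro τ hτ
    have h1 : J σ ≤ sInf (J '' 𝓣) := ge_of_tendsto' hu fun n => by
      rw [← hsu n]
      exact lintegral_mono fun ω => hg.antitone (le_iSup (fun n => s n ω) n)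
    exact h1.trans (sInf_le ⟨τ, hτ, rfl⟩)
  refine ⟨σ, hσ.1, hσ.2, ?_⟩
  have hk : ∀ k : ℕ, ∀ᵐ ω ∂P, σ ω ≠ ⊤ →
      ω.eval ((σ ω).untopD 0) ∈ Metric.cthickening (1 / ((k : ℝ) + 1)) K := by
    intro k
    let U := Metric.thickening (1 / ((k : ℝ) + 1)) K
    -- Entering a neighbourhood of `K` after `σ` still happens no later than `τ_K`, so maximality
    -- forces this entrance time to equal `σ` almost surely.
    have hτ : entranceAfter σ U ∈ 𝓣 := by
      refine ⟨isStoppingTime_entranceAfter hσ.1 Metric.isOpen_thickening, fun ω => ?_⟩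
      refine le_of_forall_gt fun a ha => ?_
      obtain ⟨b, hb, hba⟩ : ∃ b : ℝ≥0, StrongMarkovProcess.hittingTime K ω < b ∧
          (b : WithTop ℝ≥0) ≤ a := by
        by_cases hat : a = ⊤
        · lift StrongMarkovProcess.hittingTime K ω to ℝ≥0 using ha.ne_top with t
          exact ⟨t + 1, WithTop.coe_lt_coe.2 (lt_add_one t), hat ▸ le_top⟩
        · lift a to ℝ≥0 using hat
          exact ⟨a, ha, le_rfl⟩
      rw [StrongMarkovProcess.hittingTime, hittingAfter_lt_iff] at hb
      obtain ⟨j, hj, hjK⟩ := hb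
      refine lt_of_lt_of_le ?_ hba
      refine entranceAfter_lt_iff.2 ⟨j, (hσ.2 ω).trans (hittingAfter_le_of_mem hj.1 hjK), hj.2,
        Metric.self_subset_thickening (by positivity) _ hjK⟩
    have hae := ae_eq_of_ae_le_of_lintegral_le (μ := P)
      (f := fun ω => g (entranceAfter σ U ω)) (g := fun ω => g (σ ω))
      (Eventually.of_forall fun ω => hg.antitone (le_entranceAfter ω)) (hJ _)
      (hgm.comp hσ.1.measurable').aemeasurable (hmin _ hτ)
    filter_upwards [hae] with ω hω hne
    by_contra hnot
    have heq : entranceAfter σ U ω = σ ω := hg.injective hω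
    -- If the path at `σ` were off the closed thickening, right-continuity would keep it off for a
    -- while, and the entrance into `U` would come strictly later.
    have hopen : IsOpen (Metric.cthickening (1 / ((k : ℝ) + 1)) K)ᶜ :=
      Metric.isClosed_cthickening.isOpen_compl
    lift σ ω to ℝ≥0 using hne with t ht
    have hright := (ω.2 t).1.tendsto (hopen.mem_nhds hnot)
    obtain ⟨v, hv, hvs⟩ := (mem_nhdsGE_iff_exists_Ico_subset' (lt_add_one t)).1 hright
    have hlt : entranceAfter σ U ω < v := heq ▸ WithTop.coe_lt_coe.2 hv
    obtain ⟨j, hj1, hj2, hj3⟩ := entranceAfter_lt_iff.1 hlt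
    rw [← ht] at hj1
    exact hvs ⟨WithTop.coe_le_coe.1 hj1, hj2⟩ (Metric.thickening_subset_cthickening _ _ hj3)
  filter_upwards [ae_all_iff.2 hk] with ω hω hne
  rw [← hK.closure_eq, Metric.closure_eq_iInter_cthickening, Set.mem_iInter₂]
  intro δ hδ
  obtain ⟨k, hk⟩ := exists_nat_one_div_lt hδ
  exact Metric.cthickening_mono hk.le _ (hω k hne)

end EntranceTime

end CadlagPath

namespace StrongMarkovProcess

/-! ### Consequences of the strong Markov property. -/

section StrongMarkov

variable {X : Type u} [TopologicalSpace X] [MeasurableSpace X] (M : StrongMarkovProcess X)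

lemma law_map_shift (x : X) (r : ℝ≥0) :
    (M.law x).map (CadlagPath.shift r) = (M.transition r x).bind M.law := by
  ext B hB
  have h := M.strongMarkov x (fun _ => (r : WithTop ℝ≥0)) (isStoppingTime_const _ r) Set.univ
    MeasurableSet.univ B hB
  simp only [ne_eq, WithTop.coe_ne_top, not_false_eq_true, true_and, WithTop.untopD_coe,
    Set.univ_inter, Set.ofPred_true, Measure.restrict_univ] at h
  rw [Measure.map_apply (CadlagPath.measurable_shift r) hB, Measure.bind_apply hB M.law.aemeasurable,
    transition, Kernel.map_apply _ (CadlagPath.measurable_eval r),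
    lintegral_map (M.law.measurable_coe hB) (CadlagPath.measurable_eval r)]
  exact h

lemma lawFrom_map_shift (μ : Measure X) (r : ℝ≥0) :
    (M.lawFrom μ).map (CadlagPath.shift r) = M.lawFrom (μ.bind (M.transition r)) := by
  unfold lawFrom
  ext B hB
  rw [Measure.map_apply (CadlagPath.measurable_shift r) hB,
    Measure.bind_apply (CadlagPath.measurable_shift r hB) M.law.aemeasurable,
    Measure.bind_apply hB M.law.aemeasurable,
    Measure.lintegral_bind (M.transition r).aemeasurable (M.law.measurable_coe hB).aemeasurable]
  refine lintegral_congr fun x => ?_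
  rw [← Measure.map_apply (CadlagPath.measurable_shift r) hB, law_map_shift,
    Measure.bind_apply hB M.law.aemeasurable]

lemma lintegral_transition (x : X) (t : ℝ≥0) {f : X → ℝ≥0∞} (hf : Measurable f) :
    ∫⁻ y, f y ∂(M.transition t x) = ∫⁻ ω, f (ω.eval t) ∂(M.law x) := by
  rw [transition, Kernel.map_apply _ (CadlagPath.measurable_eval t),
    lintegral_map hf (CadlagPath.measurable_eval t)]

lemma transition_add (x : X) (s t : ℝ≥0) :
    M.transition (s + t) x = (M.transition s x).bind (M.transition t) := by
  ext B hB
  rw [Measure.bind_apply hB (M.transition t).aemeasurable]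
  have h : ∀ y, M.transition t y B = M.law y (CadlagPath.eval t ⁻¹' B) := fun y => by
    rw [transition, Kernel.map_apply' _ (CadlagPath.measurable_eval t) _ hB]
  simp_rw [h]
  rw [← Measure.bind_apply (CadlagPath.measurable_eval t hB) M.law.aemeasurable, ← law_map_shift,
    Measure.map_apply (CadlagPath.measurable_shift s) (CadlagPath.measurable_eval t hB), transition,
    Kernel.map_apply' _ (CadlagPath.measurable_eval _) _ hB]
  rfl

lemma transition_zero (x : X) : M.transition 0 x = Measure.dirac x := by
  rw [transition, Kernel.map_apply _ (CadlagPath.measurable_eval 0),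
    Measure.map_congr (M.start x), Measure.map_const, measure_univ, one_smul]

variable [TopologicalSpace.PseudoMetrizableSpace X] [BorelSpace X]

/-- The strong Markov property for functionals of the stopping time and the shifted trajectory. -/
lemma lintegral_shift_stoppingTime (x : X) {τ : CadlagPath X → WithTop ℝ≥0}
    (hτ : IsStoppingTime (CadlagPath.naturalFiltration X).rightCont τ)
    {H : ℝ≥0 × CadlagPath X → ℝ≥0∞} (hH : Measurable H) :
    ∫⁻ ω in {ω | τ ω ≠ ⊤}, H ((τ ω).untopD 0, CadlagPath.shift ((τ ω).untopD 0) ω) ∂(M.law x) =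
      ∫⁻ ω in {ω | τ ω ≠ ⊤}, ∫⁻ ω', H ((τ ω).untopD 0, ω')
        ∂(M.law (ω.eval ((τ ω).untopD 0))) ∂(M.law x) := by
  set T : CadlagPath X → ℝ≥0 := fun ω => (τ ω).untopD 0 with hT
  have hTτ : Measurable[hτ.measurableSpace] T := hτ.measurable.untopD 0
  have hTm : Measurable T := hτ.measurable'.untopD 0
  have hXm : Measurable fun ω : CadlagPath X => ω.eval (T ω) :=
    CadlagPath.measurable_eval_prod.comp (hTm.prodMk measurable_id)
  have hSm : Measurable fun ω : CadlagPath X => CadlagPath.shift (T ω) ω :=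
    CadlagPath.measurable_shift_prod.comp (hTm.prodMk measurable_id)
  have hPm : Measurable fun p : CadlagPath X × CadlagPath X => (T p.1, p.2) :=
    (hTm.comp measurable_fst).prodMk measurable_snd
  set ρ := (M.law x).restrict {ω | τ ω ≠ ⊤} with hρ
  let κ : Kernel (CadlagPath X) (CadlagPath X) := M.law.comap _ hXm
  -- It is enough to test rectangles `I ×ˢ B`, where the event `T ∈ I` belongs to `𝓕_τ` and the
  -- strong Markov property applies.
  have key : ρ.map (fun ω => (T ω, CadlagPath.shift (T ω) ω)) =
      (ρ ⊗ₘ κ).map (fun p => (T p.1, p.2)) := by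
    refine Measure.ext_prod fun {I B} hI hB => ?_
    rw [Measure.map_apply (hTm.prodMk hSm) (hI.prod hB),
      Measure.map_apply hPm (hI.prod hB)]
    have e : (fun p : CadlagPath X × CadlagPath X => (T p.1, p.2)) ⁻¹' (I ×ˢ B) =
      (T ⁻¹' I) ×ˢ B := rfl
    rw [e, Measure.compProd_apply_prod (hTm hI) hB, hρ,
      Measure.restrict_apply ((hTm.prodMk hSm) (hI.prod hB)), Measure.restrict_restrict (hTm hI)]
    refine Eq.trans ?_ (M.strongMarkov x τ hτ (T ⁻¹' I) (hTτ hI) B hB)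
    congr 1
    ext ω
    simp only [Set.mem_inter_iff, Set.mem_preimage, Set.mem_prod, Set.mem_ofPred_eq]
    tauto
  calc _ = ∫⁻ p, H p ∂(ρ.map (fun ω => (T ω, CadlagPath.shift (T ω) ω))) :=
        (lintegral_map hH (hTm.prodMk hSm)).symm
    _ = ∫⁻ p, H (T p.1, p.2) ∂(ρ ⊗ₘ κ) := by
        rw [key, lintegral_map hH hPm]
    _ = _ := Measure.lintegral_compProd
        (hH.comp hPm)

end StrongMarkov

end StrongMarkovProcess

lemma WithTop.le_coe_iff_untopD_le {a : WithTop ℝ≥0} {L : ℝ≥0} :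
    a ≤ L ↔ a ≠ ⊤ ∧ a.untopD 0 ≤ L := by
  induction a using WithTop.recTopCoe with
  | top => exact ⟨fun h => absurd (top_le_iff.1 h) WithTop.coe_ne_top, fun h => absurd rfl h.1⟩
  | coe r => exact ⟨fun h => ⟨WithTop.coe_ne_top, WithTop.coe_le_coe.1 h⟩,
      fun h => WithTop.coe_le_coe.2 h.2⟩

namespace StrongMarkovProcess

/-! ### Restarting the process at a visit to `K`. -/

section Visit

variable {X : Type u} [TopologicalSpace X] [MeasurableSpace X]

/-- `τ` is a stopping time at which, almost surely under `P_x`, the process is in `K`. -/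
def IsVisit (M : StrongMarkovProcess X) (K : Set X) (x : X) (τ : CadlagPath X → WithTop ℝ≥0) :
    Prop :=
  IsStoppingTime (CadlagPath.naturalFiltration X).rightCont τ ∧
    ∀ᵐ ω ∂(M.law x), τ ω ≠ ⊤ → ω.eval ((τ ω).untopD 0) ∈ K

variable {M : StrongMarkovProcess X} {K : Set X} {x : X} {τ : CadlagPath X → WithTop ℝ≥0}

lemma IsVisit.measurableSet_le (hτ : M.IsVisit K x τ) (L : ℝ≥0) : MeasurableSet {ω | τ ω ≤ L} :=
  (CadlagPath.naturalFiltration X).rightCont.le L _ (hτ.1 L)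

lemma IsVisit.setLIntegral_mono (hτ : M.IsVisit K x τ) {L : ℝ≥0} {F G : ℝ≥0 → X → ℝ≥0∞}
    (h : ∀ z ∈ K, ∀ r ≤ L, F r z ≤ G r z) :
    ∫⁻ ω in {ω | τ ω ≤ L}, F ((τ ω).untopD 0) (ω.eval ((τ ω).untopD 0)) ∂(M.law x) ≤
      ∫⁻ ω in {ω | τ ω ≤ L}, G ((τ ω).untopD 0) (ω.eval ((τ ω).untopD 0)) ∂(M.law x) := by
  refine setLIntegral_mono_ae' (hτ.measurableSet_le L) ?_
  filter_upwards [hτ.2] with ω hω hL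
  obtain ⟨h1, h2⟩ := WithTop.le_coe_iff_untopD_le.1 hL
  exact h _ (hω h1) _ h2

/-- With `p = 1 - q` the left side is `κ + (1 - κ) q`, increasing in `q`, so `q = 1/2` is the worst
case. -/
lemma add_mul_le_half_add_half {p q κ : ℝ≥0∞} (hpq : p + q = 1) (hq : q ≤ 1 / 2) (hκ : κ ≤ 1) :
    q + κ * p ≤ 1 / 2 + κ / 2 := by
  have hp : p ≤ 1 := hpq ▸ le_self_add
  have hq1 : q ≤ 1 := hpq ▸ le_add_self
  lift p to ℝ≥0 using (hp.trans_lt ENNReal.one_lt_top).ne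
  lift q to ℝ≥0 using (hq1.trans_lt ENNReal.one_lt_top).ne
  lift κ to ℝ≥0 using (hκ.trans_lt ENNReal.one_lt_top).ne
  have e : (1 : ℝ≥0∞) / 2 = ((1 / 2 : ℝ≥0) : ℝ≥0∞) := by simp
  have e' : (κ : ℝ≥0∞) / 2 = ((κ / 2 : ℝ≥0) : ℝ≥0∞) := by
    rw [ENNReal.coe_div (by simp)]; simp
  rw [e] at hq
  rw [e, e']
  norm_cast at *
  rw [← NNReal.coe_le_coe] at *
  have hpq' : (p : ℝ) + q = 1 := by exact_mod_cast hpq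
  push_cast at *
  nlinarith

lemma IsVisit.measure_add (hτ : M.IsVisit K x τ) (L : ℝ≥0) :
    M.law x {ω | τ ω ≤ L} + M.law x {ω | τ ω ≤ L}ᶜ = 1 := by
  rw [measure_add_measure_compl (hτ.measurableSet_le L), measure_univ]

variable [TopologicalSpace.PseudoMetrizableSpace X] [BorelSpace X]

lemma IsVisit.lintegral_transition_eq (hτ : M.IsVisit K x τ) {L t : ℝ≥0} (hLt : L ≤ t)
    {f : X → ℝ≥0∞} (hf : Measurable f) :
    ∫⁻ y, f y ∂(M.transition t x) =
      ∫⁻ ω in {ω | τ ω ≤ L}ᶜ, f (ω.eval t) ∂(M.law x) +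
      ∫⁻ ω in {ω | τ ω ≤ L}, ∫⁻ y, f y ∂(M.transition (t - (τ ω).untopD 0)
        (ω.eval ((τ ω).untopD 0))) ∂(M.law x) := by
  rw [lintegral_transition M x t hf, ← lintegral_add_compl _ (hτ.measurableSet_le L), add_comm]
  congr 1
  -- The indicator confines the functional to `τ ≤ L ≤ t`, where the truncated subtraction `t - τ`
  -- is a true one.
  let H : ℝ≥0 × CadlagPath X → ℝ≥0∞ := fun p =>
    (Set.Iic L).indicator 1 p.1 * f (p.2.eval (t - p.1))
  have hH : Measurable H :=
    ((measurable_one.indicator measurableSet_Iic).comp measurable_fst).mul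
      (hf.comp (CadlagPath.measurable_eval_prod.comp
        ((measurable_const.sub measurable_fst).prodMk measurable_snd)))
  have htop : MeasurableSet {ω | τ ω ≠ ⊤} :=
    (measurableSet_singleton (⊤ : WithTop ℝ≥0)).compl.preimage hτ.1.measurable'
  have hind : ∀ F : CadlagPath X → ℝ≥0∞,
      ∫⁻ ω in {ω | τ ω ≤ L}, F ω ∂(M.law x) = ∫⁻ ω in {ω | τ ω ≠ ⊤},
        (Set.Iic L).indicator 1 ((τ ω).untopD 0) * F ω ∂(M.law x) := by
    intro F
    rw [← lintegral_indicator (hτ.measurableSet_le L), ← lintegral_indicator htop]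
    refine lintegral_congr fun ω => ?_
    by_cases h : τ ω ≤ L
    · obtain ⟨h1, h2⟩ := WithTop.le_coe_iff_untopD_le.1 h
      rw [Set.indicator_of_mem (s := {ω | τ ω ≤ L}) h, Set.indicator_of_mem (s := {ω | τ ω ≠ ⊤}) h1,
        Set.indicator_of_mem (s := Set.Iic L) h2, Pi.one_apply, one_mul]
    · rw [Set.indicator_of_notMem (s := {ω | τ ω ≤ L}) h]
      by_cases h1 : τ ω = ⊤
      · rw [Set.indicator_of_notMem (s := {ω | τ ω ≠ ⊤}) (not_not.2 h1)]
      · rw [Set.indicator_of_mem (s := {ω | τ ω ≠ ⊤}) h1, Set.indicator_of_notMem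
          (s := Set.Iic L) fun h2 => h (WithTop.le_coe_iff_untopD_le.2 ⟨h1, h2⟩), zero_mul]
  rw [hind, hind]
  refine Eq.trans (lintegral_congr fun ω => ?_) ((lintegral_shift_stoppingTime M x hτ.1 hH).trans
    (lintegral_congr fun ω => ?_))
  · simp only [H]
    by_cases h : (τ ω).untopD 0 ≤ L
    · rw [CadlagPath.eval_shift, add_tsub_cancel_of_le (h.trans hLt)]
    · rw [Set.indicator_of_notMem (s := Set.Iic L) h, zero_mul, zero_mul]
  · simp only [H]
    rw [lintegral_transition M _ _ hf]
    exact lintegral_const_mul _ (hf.comp (CadlagPath.measurable_eval _))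

section Bounds

variable {L : ℝ≥0} {f : X → ℝ≥0∞}

/-- Both times are read on the same path. Without a visit the loss is at most 1, with probability at
most 1/2; after a visit both evolutions restart from the same point of `K` and lose at most `κ`. -/
lemma IsVisit.lintegral_transition_le_add (hτ : M.IsVisit K x τ)
    (hhalf : M.law x {ω | τ ω ≤ L}ᶜ ≤ 1 / 2) (hf : Measurable f) (hf1 : ∀ y, f y ≤ 1)
    {s t : ℝ≥0} (hs : L ≤ s) (ht : L ≤ t) {κ : ℝ≥0∞} (hκ : κ ≤ 1)
    (h : ∀ z ∈ K, ∀ r ≤ L, ∫⁻ y, f y ∂(M.transition (t - r) z) ≤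
      ∫⁻ y, f y ∂(M.transition (s - r) z) + κ) :
    ∫⁻ y, f y ∂(M.transition t x) ≤ ∫⁻ y, f y ∂(M.transition s x) + (1 / 2 + κ / 2) := by
  rw [hτ.lintegral_transition_eq ht hf, hτ.lintegral_transition_eq hs hf]
  have h1 : ∫⁻ ω in {ω | τ ω ≤ L}ᶜ, f (ω.eval t) ∂(M.law x) ≤ M.law x {ω | τ ω ≤ L}ᶜ := by
    refine (lintegral_mono fun ω => hf1 _).trans_eq ?_
    simp
  have h2 := hτ.setLIntegral_mono h
  rw [lintegral_add_right _ measurable_const, setLIntegral_const] at h2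
  refine (add_le_add h1 h2).trans ?_
  have := add_mul_le_half_add_half (hτ.measure_add L) hhalf hκ
  calc _ = ∫⁻ ω in {ω | τ ω ≤ L}, ∫⁻ y, f y ∂(M.transition (s - (τ ω).untopD 0)
        (ω.eval ((τ ω).untopD 0))) ∂(M.law x) +
        (M.law x {ω | τ ω ≤ L}ᶜ + κ * M.law x {ω | τ ω ≤ L}) := by ring
    _ ≤ _ := add_le_add le_add_self this

lemma IsVisit.lintegral_transition_le (hτ : M.IsVisit K x τ)
    (hhalf : M.law x {ω | τ ω ≤ L}ᶜ ≤ 1 / 2) (hf : Measurable f) (hf1 : ∀ y, f y ≤ 1)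
    {t : ℝ≥0} (ht : L ≤ t) {b : ℝ≥0∞} (hb : b ≤ 1)
    (h : ∀ z ∈ K, ∀ r ≤ L, ∫⁻ y, f y ∂(M.transition (t - r) z) ≤ b) :
    ∫⁻ y, f y ∂(M.transition t x) ≤ 1 / 2 + b / 2 := by
  rw [hτ.lintegral_transition_eq ht hf]
  have h1 : ∫⁻ ω in {ω | τ ω ≤ L}ᶜ, f (ω.eval t) ∂(M.law x) ≤ M.law x {ω | τ ω ≤ L}ᶜ := by
    refine (lintegral_mono fun ω => hf1 _).trans_eq ?_
    simp
  have h2 := hτ.setLIntegral_mono (G := fun _ _ => b) h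
  rw [setLIntegral_const] at h2
  exact (add_le_add h1 h2).trans (add_mul_le_half_add_half (hτ.measure_add L) hhalf hb)

lemma IsVisit.le_lintegral_transition (hτ : M.IsVisit K x τ)
    (hhalf : M.law x {ω | τ ω ≤ L}ᶜ ≤ 1 / 2) (hf : Measurable f)
    {t : ℝ≥0} (ht : L ≤ t) {a : ℝ≥0∞}
    (h : ∀ z ∈ K, ∀ r ≤ L, a ≤ ∫⁻ y, f y ∂(M.transition (t - r) z)) :
    a / 2 ≤ ∫⁻ y, f y ∂(M.transition t x) := by
  rw [hτ.lintegral_transition_eq ht hf]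
  have h2 := hτ.setLIntegral_mono (F := fun _ _ => a) h
  rw [setLIntegral_const] at h2
  refine le_trans ?_ (h2.trans le_add_self)
  have hp : 1 / 2 ≤ M.law x {ω | τ ω ≤ L} := by
    have h3 := (hτ.measure_add L).symm.le.trans (add_le_add le_rfl hhalf)
    nth_rw 1 [← ENNReal.add_halves 1] at h3
    exact (ENNReal.add_le_add_iff_right (by simp)).1 h3
  rw [div_eq_mul_inv, ← one_div]
  gcongr

end Bounds

end Visit

/-! ### Lyapunov bounds. -/

section Lyapunov

variable {X : Type u} [MetricSpace X] [MeasurableSpace X]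
  {M : StrongMarkovProcess X} {φ : X → ℝ} {K : Set X} {α : ℝ}

/-- Split at a level `c` beyond which the tail is below 1, uniformly over `K` and all times. -/
lemma exists_lintegral_transition_le (hφ : Measurable φ) (tail_bound : Tendsto
      (fun c : ℝ => ⨆ x ∈ K, ⨆ t : ℝ≥0,
        ∫⁻ ω in {ω | c < φ (CadlagPath.eval t ω)},
          ENNReal.ofReal (φ (CadlagPath.eval t ω)) ∂(M.law x))
      atTop (𝓝 0)) :
    ∃ C : ℝ≥0, ∀ x ∈ K, ∀ t, ∫⁻ y, ENNReal.ofReal (φ y) ∂(M.transition t x) ≤ C := by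
  obtain ⟨c, hc⟩ := (tail_bound.eventually (gt_mem_nhds (show (0 : ℝ≥0∞) < 1 by simp))).exists
  refine ⟨c.toNNReal + 1, fun x hx t => ?_⟩
  rw [lintegral_transition M x t hφ.ennreal_ofReal]
  have hm : MeasurableSet {ω : CadlagPath X | c < φ (ω.eval t)} :=
    measurableSet_lt measurable_const (hφ.comp (CadlagPath.measurable_eval t))
  rw [← lintegral_add_compl _ hm, add_comm, ENNReal.coe_add]
  gcongr
  · refine (setLIntegral_mono' hm.compl (g := fun _ => (c.toNNReal : ℝ≥0∞)) fun ω hω => ?_).trans ?_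
    · exact ENNReal.ofReal_le_ofReal (not_lt.1 hω)
    · rw [setLIntegral_const]
      exact (mul_le_mul_right prob_le_one _).trans_eq (mul_one _)
  · refine le_trans ?_ hc.le
    exact (le_iSup (fun t : ℝ≥0 => ∫⁻ ω in {ω | c < φ (CadlagPath.eval t ω)},
      ENNReal.ofReal (φ (CadlagPath.eval t ω)) ∂(M.law x)) t).trans
      (le_iSup₂ (f := fun x (_ : x ∈ K) => ⨆ t : ℝ≥0, ∫⁻ ω in {ω | c < φ (CadlagPath.eval t ω)},
        ENNReal.ofReal (φ (CadlagPath.eval t ω)) ∂(M.law x)) x hx)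

/-- As `φ ≥ 1`, the probability of no visit by time `L` is at most `e^{-αL} c` on the level set. -/
lemma exists_forall_isVisit_half (hα : 0 < α) (hφ_one : ∀ x, 1 ≤ φ x)
    (hvisit : ∀ x, ∃ τ, M.IsVisit K x τ ∧ ∀ t : ℝ≥0,
      ∫⁻ ω in {ω | τ ω ≤ t}ᶜ, ENNReal.ofReal (φ (ω.eval t)) ∂(M.law x)
        ≤ ENNReal.ofReal (Real.exp (-α * t) * φ x)) (c : ℝ) :
    ∃ L : ℝ≥0, ∀ x, φ x ≤ c → ∃ τ, M.IsVisit K x τ ∧ M.law x {ω | τ ω ≤ L}ᶜ ≤ 1 / 2 := by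
  have hlim : Tendsto (fun t : ℝ≥0 => Real.exp (-α * t) * c) atTop (𝓝 (0 * c)) := by
    refine Tendsto.mul_const _ (Real.tendsto_exp_atBot.comp ?_)
    exact (NNReal.tendsto_coe_atTop.2 tendsto_id).const_mul_atTop_of_neg (neg_neg_of_pos hα)
  rw [zero_mul] at hlim
  obtain ⟨L, hL⟩ := (hlim.eventually (gt_mem_nhds (show (0 : ℝ) < 1 / 2 by norm_num))).exists
  refine ⟨L, fun x hx => ?_⟩
  obtain ⟨τ, hτ, hb⟩ := hvisit x
  refine ⟨τ, hτ, ?_⟩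
  have h1 : M.law x {ω | τ ω ≤ L}ᶜ ≤
      ∫⁻ ω in {ω | τ ω ≤ L}ᶜ, ENNReal.ofReal (φ (ω.eval L)) ∂(M.law x) := by
    rw [← setLIntegral_one]
    refine lintegral_mono fun ω => ?_
    rw [← ENNReal.ofReal_one]
    exact ENNReal.ofReal_le_ofReal (hφ_one _)
  refine (h1.trans (hb L)).trans ?_
  have h2 : Real.exp (-α * L) * φ x ≤ 1 / 2 :=
    (mul_le_mul_of_nonneg_left hx (Real.exp_pos _).le).trans hL.le
  refine (ENNReal.ofReal_le_ofReal h2).trans_eq ?_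
  rw [ENNReal.ofReal_div_of_pos (by norm_num)]
  simp

variable [BorelSpace X]

lemma exists_isVisit (hK : IsClosed K) (hitting_bound : ∀ (x : X) (t : ℝ≥0),
      ∫⁻ ω in {ω | (t : WithTop ℝ≥0) < StrongMarkovProcess.hittingTime K ω},
          ENNReal.ofReal (φ (CadlagPath.eval t ω)) ∂(M.law x)
        ≤ ENNReal.ofReal (Real.exp (-α * t) * φ x)) (x : X) :
    ∃ τ, M.IsVisit K x τ ∧ ∀ t : ℝ≥0,
      ∫⁻ ω in {ω | τ ω ≤ t}ᶜ, ENNReal.ofReal (φ (ω.eval t)) ∂(M.law x)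
        ≤ ENNReal.ofReal (Real.exp (-α * t) * φ x) := by
  obtain ⟨τ, hτ, hle, hmem⟩ := CadlagPath.exists_stoppingTime_le_hittingTime (M.law x) hK
  refine ⟨τ, ⟨hτ, hmem⟩, fun t => le_trans (lintegral_mono_set fun ω hω => ?_) (hitting_bound x t)⟩
  exact lt_of_lt_of_le (not_le.1 (Set.notMem_of_mem_compl hω)) (hle ω)

lemma lintegral_transition_le_exp_add (hφ : Measurable φ) {C : ℝ≥0}
    (hC : ∀ x ∈ K, ∀ t, ∫⁻ y, ENNReal.ofReal (φ y) ∂(M.transition t x) ≤ C) {x : X}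
    {τ : CadlagPath X → WithTop ℝ≥0} (hτ : M.IsVisit K x τ) {t : ℝ≥0}
    (hbound : ∫⁻ ω in {ω | τ ω ≤ t}ᶜ, ENNReal.ofReal (φ (ω.eval t)) ∂(M.law x)
        ≤ ENNReal.ofReal (Real.exp (-α * t) * φ x)) :
    ∫⁻ y, ENNReal.ofReal (φ y) ∂(M.transition t x) ≤
      ENNReal.ofReal (Real.exp (-α * t) * φ x) + C := by
  rw [hτ.lintegral_transition_eq le_rfl hφ.ennreal_ofReal]
  refine add_le_add hbound ?_
  refine (hτ.setLIntegral_mono (F := fun r z => ∫⁻ y, ENNReal.ofReal (φ y) ∂(M.transition (t - r) z))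
    (G := fun _ _ => (C : ℝ≥0∞)) fun z hz r _ => hC z hz _).trans ?_
  rw [setLIntegral_const]
  exact (mul_le_mul_right prob_le_one _).trans_eq (mul_one _)

end Lyapunov

end StrongMarkovProcess

/-! ### Total variation under kernels. -/

section BindIntegral

variable {X Y : Type*} [MeasurableSpace X] [MeasurableSpace Y]

lemma integral_bind_kernel {μ : Measure X} {κ : Kernel X Y} {f : Y → ℝ}
    (hf : Integrable f (μ.bind κ)) : ∫ y, f y ∂(μ.bind κ) = ∫ x, ∫ y, f y ∂(κ x) ∂μ := by
  have e : (κ ∘ₖ Kernel.const Unit μ) () = μ.bind κ := by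
    rw [Kernel.comp_apply, Kernel.const_apply]
  rw [← e, Kernel.integral_comp (by rwa [e]), Kernel.const_apply]

lemma measurable_integral_kernel {κ : Kernel X Y} [IsSFiniteKernel κ] {f : Y → ℝ}
    (hf : Measurable f) : Measurable fun x => ∫ y, f y ∂(κ x) :=
  (StronglyMeasurable.integral_kernel hf.stronglyMeasurable).measurable

lemma integral_mem_Icc {μ : Measure X} [IsProbabilityMeasure μ] {f : X → ℝ} (hf : Measurable f)
    {a b : ℝ} (ha : ∀ x, a ≤ f x) (hb : ∀ x, f x ≤ b) : a ≤ ∫ x, f x ∂μ ∧ ∫ x, f x ∂μ ≤ b := by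
  have hi : Integrable f μ := integrable_of_mem_Icc hf ha hb
  constructor
  · simpa using integral_mono (integrable_const a) hi ha
  · simpa using integral_mono hi (integrable_const b) hb

lemma TVLe.bind {μ ν : Measure X} [IsProbabilityMeasure μ] [IsProbabilityMeasure ν]
    {κ : ℝ} (h : TVLe κ μ ν) (P : Kernel X Y) [IsMarkovKernel P] :
    TVLe κ (μ.bind P) (ν.bind P) := by
  intro f hf h0 h1
  rw [integral_bind_kernel (integrable_of_mem_Icc hf h0 h1),
    integral_bind_kernel (integrable_of_mem_Icc hf h0 h1)]
  exact h _ (measurable_integral_kernel hf) (fun x => (integral_mem_Icc hf h0 h1).1)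
    (fun x => (integral_mem_Icc hf h0 h1).2)

lemma TVLe.symm {μ ν : Measure X} [IsProbabilityMeasure μ] [IsProbabilityMeasure ν]
    {κ : ℝ} (h : TVLe κ μ ν) : TVLe κ ν μ := by
  intro f hf h0 h1
  have := h (fun x => 1 - f x) (by fun_prop) (fun x => sub_nonneg.2 (h1 x))
    (fun x => by linarith [h0 x])
  rw [integral_sub (integrable_const _) (integrable_of_mem_Icc hf h0 h1),
    integral_sub (integrable_const _) (integrable_of_mem_Icc hf h0 h1)] at this
  simp only [integral_const, probReal_univ, smul_eq_mul, one_mul] at this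
  linarith

lemma integral_le_add_iff_lintegral {μ ν : Measure X} [IsProbabilityMeasure μ]
    [IsProbabilityMeasure ν] {κ : ℝ} (hκ : 0 ≤ κ) {f : X → ℝ} (hf : Measurable f)
    (h0 : ∀ x, 0 ≤ f x) (h1 : ∀ x, f x ≤ 1) :
    ∫ x, f x ∂μ ≤ ∫ x, f x ∂ν + κ ↔
      ∫⁻ x, ENNReal.ofReal (f x) ∂μ ≤ ∫⁻ x, ENNReal.ofReal (f x) ∂ν + ENNReal.ofReal κ := by
  have hν : 0 ≤ ∫ x, f x ∂ν := integral_nonneg h0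
  rw [← ofReal_integral_eq_lintegral_ofReal (integrable_of_mem_Icc hf h0 h1)
      (Eventually.of_forall h0), ← ofReal_integral_eq_lintegral_ofReal
      (integrable_of_mem_Icc hf h0 h1) (Eventually.of_forall h0), ← ENNReal.ofReal_add hν hκ,
    ENNReal.ofReal_le_ofReal_iff (add_nonneg hν hκ)]

/-- Two initial laws that partially overlap, followed by evolutions that partially overlap when
started from a common point of `G`. -/
lemma TVLe.integral_le_integral_add {μ ν : Measure X} [IsProbabilityMeasure μ]
    [IsProbabilityMeasure ν] {κ ε η : ℝ} (hμν : TVLe κ μ ν) {g h : X → ℝ} (hg : Measurable g)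
    (hh : Measurable h) (hg1 : ∀ x, g x ≤ 1) (hh0 : ∀ x, 0 ≤ h x) (hh1 : ∀ x, h x ≤ 1)
    (hg0 : ∀ x, 0 ≤ g x) (hη : 0 < η) {G : Set X} (hG : MeasurableSet G)
    (hgh : ∀ x ∈ G, g x ≤ h x + (1 - η)) (hε : ν.real Gᶜ ≤ ε) :
    ∫ x, g x ∂μ ≤ ∫ x, h x ∂ν + (1 - η * (1 - κ - ε)) := by
  classical
  -- `k` dominates `g`, and its range lies in an interval of length only `η`, so passing from `μ` to
  -- `ν` costs `κη` instead of `κ`.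
  let k : X → ℝ := fun x => if x ∈ G then min 1 (h x + (1 - η)) else 1
  have hk : Measurable k := Measurable.ite hG (measurable_const.min (hh.add_const _)) measurable_const
  have hk0 : ∀ x, 1 - η ≤ k x := fun x => by
    simp only [k]
    split_ifs
    · exact le_min (by linarith) (by linarith [hh0 x])
    · linarith
  have hk1 : ∀ x, k x ≤ 1 := fun x => by
    simp only [k]
    split_ifs
    · exact min_le_left _ _
    · exact le_rfl
  have hgk : ∀ x, g x ≤ k x := fun x => by
    simp only [k]
    split_ifs with hx
    · exact le_min (hg1 x) (hgh x hx)
    · exact hg1 x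
  have hkh : ∀ x, k x ≤ h x + (1 - η) + Gᶜ.indicator (fun _ => η) x := fun x => by
    simp only [k]
    split_ifs with hx
    · rw [Set.indicator_of_notMem (by simpa using hx), add_zero]
      exact min_le_right _ _
    · rw [Set.indicator_of_mem (by simpa using hx)]
      linarith [hh0 x]
  have e1 : ∫ x, g x ∂μ ≤ ∫ x, k x ∂μ :=
    integral_mono (integrable_of_mem_Icc hg hg0 hg1) (integrable_of_mem_Icc hk hk0 hk1) hgk
  have e2 := hμν.integral_sub_le hk (by linarith) hk0 hk1
  have hind : Integrable (Gᶜ.indicator (fun _ => η)) ν := (integrable_const η).indicator hG.compl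
  have hhi : Integrable h ν := integrable_of_mem_Icc hh hh0 hh1
  have hhη : Integrable (fun x => h x + (1 - η)) ν := hhi.add (integrable_const _)
  have e3 : ∫ x, k x ∂ν ≤ ∫ x, h x ∂ν + (1 - η) + ν.real Gᶜ * η := by
    refine (integral_mono (integrable_of_mem_Icc hk hk0 hk1)
      (hhη.add hind) hkh).trans_eq ?_
    rw [integral_add' hhη hind, integral_add hhi (integrable_const _),
      integral_indicator_const _ hG.compl]
    simp
  nlinarith [mul_le_mul_of_nonneg_right hε hη.le]

end BindIntegral

namespace StrongMarkovProcess

/-! ### From the extended Doeblin condition on `K` to level sets. -/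

section Doeblin

variable {X : Type u} [TopologicalSpace X] [MeasurableSpace X] {M : StrongMarkovProcess X}

lemma DoeblinOn.exists_tvLe {A : Set X} (h : M.DoeblinOn A) :
    ∃ T : ℝ≥0, ∃ κ : ℝ, 0 ≤ κ ∧ κ < 1 ∧ ∀ x ∈ A, ∀ y ∈ A,
      TVLe κ (M.transition T x) (M.transition T y) := by
  obtain ⟨T, -, hT⟩ := h
  refine ⟨T, (M.doeblinCoeff T A).toReal, ENNReal.toReal_nonneg, ?_, fun x hx y hy => ?_⟩
  · rw [← ENNReal.toReal_one]
    exact ENNReal.toReal_strict_mono ENNReal.one_ne_top hT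
  · refine tvLe_of_varDist_le hT.ne_top ?_
    unfold doeblinCoeff
    exact le_iSup₂_of_le x hx (le_iSup₂_of_le y hy le_rfl)

lemma ExtendedDoeblinOn.exists_tvLe {A : Set X} (h : M.ExtendedDoeblinOn A) :
    ∃ T₁ T₂ : ℝ≥0, T₁ < T₂ ∧ ∃ κ : ℝ, 0 ≤ κ ∧ κ < 1 ∧ ∀ x ∈ A, ∀ y ∈ A, ∀ s ∈ Set.Icc T₁ T₂,
      ∀ t ∈ Set.Icc T₁ T₂, TVLe κ (M.transition s x) (M.transition t y) := by
  obtain ⟨T₁, T₂, -, hT, hlt⟩ := h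
  refine ⟨T₁, T₂, hT, (M.extendedDoeblinCoeff T₁ T₂ A).toReal, ENNReal.toReal_nonneg, ?_,
    fun x hx y hy s hs t ht => ?_⟩
  · rw [← ENNReal.toReal_one]
    exact ENNReal.toReal_strict_mono ENNReal.one_ne_top hlt
  · refine tvLe_of_varDist_le hlt.ne_top ?_
    unfold extendedDoeblinCoeff
    exact le_iSup₂_of_le x hx (le_iSup₂_of_le y hy (le_iSup₂_of_le s hs (le_iSup₂_of_le t ht le_rfl)))

lemma tvLe_transition_add {κ : ℝ} {x y : X} {s t : ℝ≥0}
    (h : TVLe κ (M.transition s x) (M.transition t y)) (r : ℝ≥0) :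
    TVLe κ (M.transition (s + r) x) (M.transition (t + r) y) := by
  rw [transition_add, transition_add]
  exact h.bind _

lemma integral_transition_add (x : X) (s t : ℝ≥0) {f : X → ℝ}
    (hf : Integrable f (M.transition (s + t) x)) :
    ∫ y, f y ∂(M.transition (s + t) x) =
      ∫ z, ∫ y, f y ∂(M.transition t z) ∂(M.transition s x) := by
  rw [transition_add] at hf ⊢
  exact integral_bind_kernel hf

variable [TopologicalSpace.PseudoMetrizableSpace X] [BorelSpace X] {K : Set X} {φ : X → ℝ}

/-- Induction on the allowed lag in units of `T₂ - T₁`. Running one process for `T₁` and the other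
for `T₁ + e` removes `e` from the lag while the laws still overlap. From a common point `z` of
moderate `φ`, a return to `K` brings in the induction hypothesis with equal starting points. -/
lemma exists_tvLe_of_lag (hφ : Measurable φ) {T₁ T₂ : ℝ≥0} (hT : T₁ < T₂) {κ : ℝ} (hκ0 : 0 ≤ κ)
    (hκ : κ < 1)
    (hTV : ∀ x ∈ K, ∀ y ∈ K, ∀ s ∈ Set.Icc T₁ T₂, ∀ t ∈ Set.Icc T₁ T₂,
      TVLe κ (M.transition s x) (M.transition t y))
    (hhalf : ∀ c : ℝ, ∃ L : ℝ≥0, ∀ x, φ x ≤ c →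
      ∃ τ, M.IsVisit K x τ ∧ M.law x {ω | τ ω ≤ L}ᶜ ≤ 1 / 2)
    {C : ℝ≥0} (hC : ∀ x ∈ K, ∀ t, ∫⁻ y, ENNReal.ofReal (φ y) ∂(M.transition t x) ≤ C) (n : ℕ) :
    ∃ T : ℝ≥0, ∃ κ' : ℝ, 0 ≤ κ' ∧ κ' < 1 ∧ ∀ x ∈ K, ∀ y ∈ K, ∀ s t : ℝ≥0, T ≤ s → T ≤ t →
      s ≤ t + n * (T₂ - T₁) → t ≤ s + n * (T₂ - T₁) →
        TVLe κ' (M.transition s x) (M.transition t y) := by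
  induction n with
  | zero =>
    refine ⟨T₁, κ, hκ0, hκ, fun x hx y hy s t hs ht hst hts => ?_⟩
    have : s = t := le_antisymm (by simpa using hst) (by simpa using hts)
    subst this
    have h := tvLe_transition_add (hTV x hx y hy T₁ ⟨le_rfl, hT.le⟩ T₁ ⟨le_rfl, hT.le⟩) (s - T₁)
    rwa [add_tsub_cancel_of_le hs] at h
  | succ n ih =>
    obtain ⟨T, κ', hκ'0, hκ'1, ih⟩ := ih
    have h1κ : 0 < 1 - κ := sub_pos.2 hκ
    -- By Markov's inequality the level set `φ ≤ c` then misses at most half of the overlap `1 - κ`.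
    obtain ⟨c, hcC, hc0⟩ : ∃ c : ℝ, (C : ℝ) / c ≤ (1 - κ) / 2 ∧ 0 < c := by
      refine ⟨(C + 1) / ((1 - κ) / 2), ?_, by positivity⟩
      rw [div_div_eq_mul_div, div_le_iff₀ (by positivity)]
      nlinarith [C.2]
    obtain ⟨L, hL⟩ := hhalf c
    -- The overlap left from `z`: a return to `K` by time `L`, of probability at least 1/2, followed
    -- by the overlap `1 - κ'`.
    let η : ℝ := (1 - κ') / 2
    have hη : 0 < η := half_pos (sub_pos.2 hκ'1)
    have hη1 : η ≤ 1 := by simp only [η]; linarith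
    refine ⟨T₂ + L + T, 1 - η * (1 - κ - (1 - κ) / 2), by nlinarith, by nlinarith,
      fun x hx y hy s t hs ht hst hts => ?_⟩
    wlog hle : s ≤ t generalizing x y s t
    · exact (this y hy x hx t s ht hs hts hst (le_of_not_ge hle)).symm
    let e : ℝ≥0 := min (t - s) (T₂ - T₁)
    have heT : T₁ + e ≤ T₂ := by
      calc T₁ + e ≤ T₁ + (T₂ - T₁) := by gcongr; exact min_le_right _ _
        _ = T₂ := add_tsub_cancel_of_le hT.le
    have hs1 : L + T ≤ s - T₁ := by
      refine le_tsub_of_add_le_left ((add_le_add_left hT.le _).trans ?_)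
      rwa [← add_assoc]
    have ht1 : L + T ≤ t - (T₁ + e) := by
      refine le_tsub_of_add_le_left ((add_le_add_left heT _).trans ?_)
      rwa [← add_assoc]
    have hTs : T₁ ≤ s := hT.le.trans (le_trans (by rw [add_assoc]; exact le_self_add) hs)
    have hTt : T₁ + e ≤ t := heT.trans (le_trans (by rw [add_assoc]; exact le_self_add) ht)
    have hlag1 : s - T₁ ≤ t - (T₁ + e) := by
      rw [← NNReal.coe_le_coe, NNReal.coe_sub hTs, NNReal.coe_sub hTt, NNReal.coe_add]
      have : (e : ℝ) ≤ t - s := by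
        rw [← NNReal.coe_sub hle]; exact NNReal.coe_le_coe.2 (min_le_left _ _)
      linarith
    have hlag2 : t - (T₁ + e) ≤ s - T₁ + n * (T₂ - T₁) := by
      rw [← NNReal.coe_le_coe, NNReal.coe_add, NNReal.coe_sub hTs, NNReal.coe_sub hTt,
        NNReal.coe_add, NNReal.coe_mul, NNReal.coe_sub hT.le]
      have hts' : (t : ℝ) ≤ s + (n + 1) * (T₂ - T₁) := by
        have := NNReal.coe_le_coe.2 hts
        rw [NNReal.coe_add, NNReal.coe_mul, NNReal.coe_sub hT.le] at this
        push_cast at this ⊢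
        exact this
      have hnn : (0 : ℝ) ≤ n * (T₂ - T₁) :=
        mul_nonneg n.cast_nonneg (sub_nonneg.2 (NNReal.coe_le_coe.2 hT.le))
      have he : (e : ℝ) = min ((t : ℝ) - s) (T₂ - T₁) := by
        rw [← NNReal.coe_sub hle, ← NNReal.coe_sub hT.le]; exact NNReal.coe_min _ _
      rcases min_choice ((t : ℝ) - s) (T₂ - T₁) with h | h
      · rw [he, h, NNReal.coe_natCast]; linarith
      · rw [he, h, NNReal.coe_natCast]; linarith
    intro f hf h0 h1
    have hTVxy := hTV x hx y hy T₁ ⟨le_rfl, hT.le⟩ (T₁ + e) ⟨le_self_add, heT⟩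
    have es := integral_transition_add (M := M) x T₁ (s - T₁) (f := f) (integrable_of_mem_Icc hf h0 h1)
    have et := integral_transition_add (M := M) y (T₁ + e) (t - (T₁ + e)) (f := f)
      (integrable_of_mem_Icc hf h0 h1)
    rw [add_tsub_cancel_of_le hTs] at es
    rw [add_tsub_cancel_of_le hTt] at et
    rw [es, et, sub_le_iff_le_add']
    refine hTVxy.integral_le_integral_add (G := {z | φ z ≤ c}) (measurable_integral_kernel hf)
      (measurable_integral_kernel hf) (fun z => (integral_mem_Icc hf h0 h1).2)
      (fun z => (integral_mem_Icc hf h0 h1).1) (fun z => (integral_mem_Icc hf h0 h1).2)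
      (fun z => (integral_mem_Icc hf h0 h1).1) hη (measurableSet_le hφ measurable_const)
      (fun z hz => ?_) ?_
    · obtain ⟨τ, hτ, hhf⟩ := hL z hz
      have e1 : 1 - η = 1 / 2 + κ' / 2 := by simp only [η]; ring
      rw [e1, integral_le_add_iff_lintegral (by positivity) hf h0 h1,
        ENNReal.ofReal_add (by norm_num) (by positivity), ENNReal.ofReal_div_of_pos (by norm_num),
        ENNReal.ofReal_div_of_pos (by norm_num), ENNReal.ofReal_one, ENNReal.ofReal_ofNat]
      refine hτ.lintegral_transition_le_add hhf hf.ennreal_ofReal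
        (fun y => by rw [← ENNReal.ofReal_one]; exact ENNReal.ofReal_le_ofReal (h1 y))
        (le_self_add.trans ht1) (le_self_add.trans hs1)
        (by rw [← ENNReal.ofReal_one]; exact ENNReal.ofReal_le_ofReal hκ'1.le) fun z' hz' r hr => ?_
      rw [← integral_le_add_iff_lintegral hκ'0 hf h0 h1, ← sub_le_iff_le_add']
      -- The visit removes the same time `r` from both clocks, so the lag does not grow.
      refine ih z' hz' z' hz' _ _ (le_tsub_of_add_le_left ((add_le_add_left hr _).trans hs1))
        (le_tsub_of_add_le_left ((add_le_add_left hr _).trans ht1)) ?_ ?_ f hf h0 h1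
      · exact (tsub_le_tsub_right hlag1 r).trans le_self_add
      · exact (tsub_le_tsub_right hlag2 r).trans add_tsub_le_tsub_add
    · have hm := mul_meas_ge_le_lintegral (μ := M.transition (T₁ + e) y) hφ.ennreal_ofReal
        (ENNReal.ofReal c)
      have hsub : {z | φ z ≤ c}ᶜ ⊆ {z | ENNReal.ofReal c ≤ ENNReal.ofReal (φ z)} := fun z hz =>
        ENNReal.ofReal_le_ofReal (le_of_not_ge hz)
      have hm2 : ENNReal.ofReal c * M.transition (T₁ + e) y {z | φ z ≤ c}ᶜ ≤ C :=
        ((mul_le_mul_right (measure_mono hsub) _).trans hm).trans (hC y hy _)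
      have hm3 := ENNReal.toReal_mono ENNReal.coe_ne_top hm2
      rw [ENNReal.toReal_mul, ENNReal.toReal_ofReal hc0.le, ENNReal.coe_toReal] at hm3
      refine le_trans ?_ hcC
      rw [le_div_iff₀ hc0, mul_comm]
      exact hm3

/-- The extended Doeblin condition on `K` implies the Doeblin condition on every level set. -/
lemma exists_tvLe_level (hφ : Measurable φ) (hext : M.ExtendedDoeblinOn K)
    (hhalf : ∀ c : ℝ, ∃ L : ℝ≥0, ∀ x, φ x ≤ c →
      ∃ τ, M.IsVisit K x τ ∧ M.law x {ω | τ ω ≤ L}ᶜ ≤ 1 / 2)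
    {C : ℝ≥0} (hC : ∀ x ∈ K, ∀ t, ∫⁻ y, ENNReal.ofReal (φ y) ∂(M.transition t x) ≤ C) (c : ℝ) :
    ∃ T : ℝ≥0, ∃ κ : ℝ, 0 ≤ κ ∧ κ < 1 ∧ ∀ x, φ x ≤ c → ∀ y, φ y ≤ c →
      TVLe κ (M.transition T x) (M.transition T y) := by
  obtain ⟨T₁, T₂, hT, κ, hκ0, hκ1, hTV⟩ := hext.exists_tvLe
  obtain ⟨L, hL⟩ := hhalf c
  -- The visits from `x` and `y` happen at unrelated times in `[0, L]`, so the lag to absorb can be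
  -- as large as `L`.
  obtain ⟨n, hn⟩ := exists_nat_ge (L / (T₂ - T₁))
  have hnL : L ≤ n * (T₂ - T₁) := (div_le_iff₀ (tsub_pos_of_lt hT)).1 hn
  obtain ⟨T, κ', hκ'0, hκ'1, h⟩ := exists_tvLe_of_lag hφ hT hκ0 hκ1 hTV hhalf hC n
  refine ⟨T + L, (1 + κ') / 2, by positivity, by linarith, fun x hx y hy f hf h0 h1 => ?_⟩
  obtain ⟨τ, hτ, hτh⟩ := hL x hx
  obtain ⟨σ, hσ, hσh⟩ := hL y hy
  rw [sub_le_iff_le_add', integral_le_add_iff_lintegral (by positivity) hf h0 h1, add_div,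
    ENNReal.ofReal_add (by norm_num) (by positivity), ENNReal.ofReal_div_of_pos (by norm_num),
    ENNReal.ofReal_div_of_pos (by norm_num), ENNReal.ofReal_one, ENNReal.ofReal_ofNat]
  have hF1 : ∀ y, ENNReal.ofReal (f y) ≤ 1 := fun y => by
    rw [← ENNReal.ofReal_one]; exact ENNReal.ofReal_le_ofReal (h1 y)
  -- A constant separates the two sides: every visit from `y` yields at least `m`, every visit from
  -- `x` at most `m + κ'`. No joint construction of the visits is needed.
  let m : ℝ≥0∞ := ⨅ z ∈ K, ⨅ r ≤ L, ∫⁻ y, ENNReal.ofReal (f y) ∂(M.transition (T + L - r) z)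
  have hlow := hσ.le_lintegral_transition hσh hf.ennreal_ofReal (t := T + L) le_add_self (a := m)
    fun z hz r hr => iInf₂_le_of_le z hz (iInf₂_le_of_le r hr le_rfl)
  have hTr : ∀ r ≤ L, T ≤ T + L - r := fun r hr => le_tsub_of_add_le_right (by gcongr)
  have hup := hτ.lintegral_transition_le hτh hf.ennreal_ofReal hF1 (t := T + L) le_add_self
    (b := min 1 (m + ENNReal.ofReal κ')) (min_le_left _ _) fun z hz r hr => by
      refine le_min ((lintegral_mono hF1).trans (by simp)) ?_
      rw [← tsub_le_iff_right]
      refine le_iInf₂ fun z' hz' => le_iInf₂ fun r' hr' => ?_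
      rw [tsub_le_iff_right, ← integral_le_add_iff_lintegral hκ'0 hf h0 h1, ← sub_le_iff_le_add']
      have aux : ∀ r r', r' ≤ L → T + L - r ≤ T + L - r' + n * (T₂ - T₁) := fun r r' hr' => by
        have h3 : T + L ≤ T + L - r' + n * (T₂ - T₁) := by
          calc T + L = T + L - r' + r' := (tsub_add_cancel_of_le (hr'.trans le_add_self)).symm
            _ ≤ _ := by gcongr; exact hr'.trans hnL
        exact tsub_le_self.trans h3
      exact h z hz z' hz' _ _ (hTr r hr) (hTr r' hr') (aux r r' hr') (aux r' r hr) f hf h0 h1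
  refine hup.trans ?_
  calc 1 / 2 + min 1 (m + ENNReal.ofReal κ') / 2
      ≤ 1 / 2 + (m + ENNReal.ofReal κ') / 2 := by
        gcongr
        exact min_le_right _ _
    _ = m / 2 + (1 / 2 + ENNReal.ofReal κ' / 2) := by rw [ENNReal.add_div]; ring
    _ ≤ _ := by gcongr

end Doeblin

end StrongMarkovProcess

/-! ### Harris' weighted contraction. -/

section Harris

/-- Take `c = sup (f - w)`. A bound on all differences thereby becomes a weighted sup bound modulo
constants. -/
lemma exists_forall_abs_sub_le {X : Type*} [Nonempty X] {f w : X → ℝ}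
    (h : ∀ x y, f x - f y ≤ w x + w y) : ∃ c, ∀ x, |f x - c| ≤ w x := by
  have hb : BddAbove (Set.range fun x => f x - w x) := by
    obtain ⟨y⟩ := ‹Nonempty X›
    refine ⟨f y + w y, ?_⟩
    rintro _ ⟨x, rfl⟩
    have := h x y
    simp only
    linarith
  refine ⟨⨆ x, (f x - w x), fun x => abs_le.2 ⟨?_, ?_⟩⟩
  · have : ⨆ x, (f x - w x) ≤ f x + w x := ciSup_le fun y => by linarith [h y x]
    linarith
  · have : f x - w x ≤ ⨆ x, (f x - w x) := le_ciSup hb x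
    linarith

variable {X : Type*} [MeasurableSpace X] {φ : X → ℝ}

lemma integrable_of_abs_sub_le {μ : Measure X} [IsFiniteMeasure μ] (hμ : Integrable φ μ)
    {f : X → ℝ} (hf : Measurable f) {c a b : ℝ} (h : ∀ x, |f x - c| ≤ a + b * φ x) :
    Integrable f μ := by
  have h1 : Integrable (fun x => f x - c) μ :=
    ((integrable_const a).add (hμ.const_mul b)).mono' (hf.sub_const c).aestronglyMeasurable
      (Eventually.of_forall h)
  exact (h1.add (integrable_const c)).congr (Eventually.of_forall fun x => by simp)

lemma abs_integral_le_const_add {μ : Measure X} [IsProbabilityMeasure μ] (hμ : Integrable φ μ)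
    {f : X → ℝ} {a b : ℝ} (h : ∀ x, |f x| ≤ a + b * φ x) :
    |∫ x, f x ∂μ| ≤ a + b * ∫ x, φ x ∂μ := by
  refine abs_integral_le_integral_abs.trans ?_
  refine (integral_mono_of_nonneg (Eventually.of_forall fun x => abs_nonneg _)
    ((integrable_const a).add (hμ.const_mul b)) (Eventually.of_forall h)).trans_eq ?_
  rw [integral_add' (integrable_const a) (hμ.const_mul b), integral_const_mul]
  simp

/-- One step of the weighted contraction in Harris' theorem. -/
lemma integral_sub_integral_le_of_harris [Nonempty X] {P : Kernel X X} [IsMarkovKernel P]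
    (hφ_one : ∀ x, 1 ≤ φ x) {C κ R b γ : ℝ} (hint : ∀ x, Integrable φ (P x))
    (hlyap : ∀ x, ∫ y, φ y ∂(P x) ≤ φ x / 2 + C)
    (hTV : ∀ x, φ x ≤ R → ∀ y, φ y ≤ R → TVLe κ (P x) (P y))
    (hb : 0 < b) (hbC : 2 * b * C ≤ 1 - κ) (hRC : 8 * C ≤ R) (hR : 0 ≤ R)
    (hγ1 : (1 + κ) / 2 ≤ γ) (hγ2 : 1 / 2 ≤ γ) (hγR : 2 + 3 / 4 * (b * R) ≤ γ * (2 + b * R))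
    {f : X → ℝ} (hf : Measurable f) (h : ∀ x y, f x - f y ≤ 2 + b * φ x + b * φ y) (x y : X) :
    ∫ z, f z ∂(P x) - ∫ z, f z ∂(P y) ≤ γ * (2 + b * φ x + b * φ y) := by
  obtain ⟨c, hc⟩ := exists_forall_abs_sub_le (w := fun x => 1 + b * φ x)
    (fun x y => (h x y).trans_eq (by ring))
  have hfi : ∀ x, Integrable f (P x) := fun x => integrable_of_abs_sub_le (hint x) hf hc
  have hsub : ∀ x, ∫ z, (f z - c) ∂(P x) = ∫ z, f z ∂(P x) - c := fun x => by
    rw [integral_sub (hfi x) (integrable_const c)]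
    simp
  have hx0 := hφ_one x
  have hy0 := hφ_one y
  have hPx := mul_le_mul_of_nonneg_left (hlyap x) hb.le
  have hPy := mul_le_mul_of_nonneg_left (hlyap y) hb.le
  -- When `φ x + φ y` is large, the Lyapunov bound alone contracts: `2bC ≤ bR/4` leaves at most `2 +
  -- (3/4) b (φ x + φ y)`.
  by_cases hS : R ≤ φ x + φ y
  · have h1 := abs_le.1 (abs_integral_le_const_add (hint x) hc)
    have h2 := abs_le.1 (abs_integral_le_const_add (hint y) hc)
    rw [hsub] at h1 h2
    have hbS : b * R ≤ b * (φ x + φ y) := mul_le_mul_of_nonneg_left hS hb.le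
    have hbC' : b * (8 * C) ≤ b * R := mul_le_mul_of_nonneg_left hRC hb.le
    have h34 : 3 / 4 ≤ γ := by
      by_contra hlt
      nlinarith [mul_nonneg hb.le hR]
    nlinarith
  · have hxR : φ x ≤ R := by linarith
    have hyR : φ y ≤ R := by linarith
    -- The truncation gains from total variation, at cost `2κ`; the remainder, below `bφ`, gains
    -- from the Lyapunov bound. The term `2bC` is paid from `1 - κ`.
    let f₁ : X → ℝ := fun z => max (-1) (min 1 (f z - c))
    have hf₁ : Measurable f₁ := measurable_const.max (measurable_const.min (hf.sub_const c))
    have hf₁a : ∀ z, -1 ≤ f₁ z := fun z => le_max_left _ _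
    have hf₁b : ∀ z, f₁ z ≤ 1 := fun z => max_le (by norm_num) (min_le_left _ _)
    have hf₂ : ∀ z, |f z - c - f₁ z| ≤ 0 + b * φ z := fun z => by
      have hz := abs_le.1 (hc z)
      have hφz : 0 < b * φ z := mul_pos hb (by linarith [hφ_one z])
      simp only [f₁]
      rw [abs_le]
      rcases le_total 1 (f z - c) with h1 | h1
      · rw [min_eq_left h1, max_eq_right (by norm_num)]
        constructor <;> linarith
      · rw [min_eq_right h1]
        rcases le_total (-1) (f z - c) with h2 | h2
        · rw [max_eq_right h2]
          constructor <;> linarith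
        · rw [max_eq_left h2]
          constructor <;> linarith
    have hf₁i : ∀ x, Integrable f₁ (P x) := fun x => integrable_of_mem_Icc hf₁ hf₁a hf₁b
    have hdec : ∀ x, ∫ z, (f z - c - f₁ z) ∂(P x) = ∫ z, f z ∂(P x) - c - ∫ z, f₁ z ∂(P x) :=
      fun x => by
        have hi : Integrable (fun z => f z - c) (P x) := (hfi x).sub (integrable_const c)
        rw [integral_sub hi (hf₁i x), hsub]
    have h1 := abs_le.1 (abs_integral_le_const_add (hint x) hf₂)
    have h2 := abs_le.1 (abs_integral_le_const_add (hint y) hf₂)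
    rw [hdec] at h1 h2
    have h3 := (hTV x hxR y hyR).integral_sub_le hf₁ (by norm_num) hf₁a hf₁b
    nlinarith [mul_nonneg (sub_nonneg.2 hγ2) (mul_pos hb (by linarith : 0 < φ x + φ y)).le]

end Harris

namespace StrongMarkovProcess

/-! ### Geometric ergodicity along a skeleton. -/

section Ergodic

variable {X : Type u} [TopologicalSpace X] [MeasurableSpace X]

/-- Geometric contraction of the skeleton `(X_{nT})`, tested on functions bounded by `φ`. -/
def IsGeometric (M : StrongMarkovProcess X) (φ : X → ℝ) (T : ℝ≥0) (A γ : ℝ) : Prop :=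
  ∀ f : X → ℝ, Measurable f → (∀ x, |f x| ≤ φ x) → ∀ (x y : X) (n : ℕ),
    ∫ z, f z ∂(M.transition (n * T) x) - ∫ z, f z ∂(M.transition (n * T) y) ≤
      A * γ ^ n * (φ x + φ y)

variable {M : StrongMarkovProcess X} {φ : X → ℝ}

lemma integrable_transition_and_integral_le (hφ : Measurable φ) (hφ_one : ∀ x, 1 ≤ φ x) {C : ℝ≥0}
    {t : ℝ≥0} {a : ℝ} (ha : 0 ≤ a) {x : X}
    (h : ∫⁻ y, ENNReal.ofReal (φ y) ∂(M.transition t x) ≤ ENNReal.ofReal (a * φ x) + C) :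
    Integrable φ (M.transition t x) ∧ ∫ y, φ y ∂(M.transition t x) ≤ a * φ x + C := by
  have h0 : ∀ x, 0 ≤ φ x := fun x => zero_le_one.trans (hφ_one x)
  have hne : ENNReal.ofReal (a * φ x) + C ≠ ∞ := by simp
  have hi : Integrable φ (M.transition t x) :=
    (lintegral_ofReal_ne_top_iff_integrable hφ.aestronglyMeasurable (Eventually.of_forall h0)).1
      (ne_top_of_le_ne_top hne h)
  refine ⟨hi, ?_⟩
  rw [← ofReal_integral_eq_lintegral_ofReal hi (Eventually.of_forall h0), ← ENNReal.ofReal_coe_nnreal,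
    ← ENNReal.ofReal_add (mul_nonneg ha (h0 x)) C.coe_nonneg] at h
  exact (ENNReal.ofReal_le_ofReal_iff (add_nonneg (mul_nonneg ha (h0 x)) C.coe_nonneg)).1 h

lemma exists_isGeometric [Nonempty X] {α C : ℝ} (hα : 0 < α)
    (hφ_one : ∀ x, 1 ≤ φ x) (hint : ∀ t x, Integrable φ (M.transition t x))
    (hC : 0 ≤ C)
    (hlyap : ∀ (t : ℝ≥0) x, ∫ y, φ y ∂(M.transition t x) ≤ Real.exp (-α * t) * φ x + C)
    (hlevel : ∀ c : ℝ, ∃ T : ℝ≥0, ∃ κ : ℝ, 0 ≤ κ ∧ κ < 1 ∧ ∀ x, φ x ≤ c → ∀ y, φ y ≤ c →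
      TVLe κ (M.transition T x) (M.transition T y)) :
    ∃ T > 0, ∃ A > 0, ∃ γ > 0, γ < 1 ∧ M.IsGeometric φ T A γ := by
  let R : ℝ := 8 * C + 8
  obtain ⟨T₀, κ, hκ0, hκ1, hTV⟩ := hlevel R
  -- Total variation bounds persist at later times, so `T` may be enlarged until the Lyapunov factor
  -- is at most 1/2.
  obtain ⟨T, hT₀, hT0, hTα⟩ : ∃ T : ℝ≥0, T₀ ≤ T ∧ 0 < T ∧ Real.exp (-α * T) ≤ 1 / 2 := by
    have hlim : Tendsto (fun t : ℝ≥0 => Real.exp (-α * t)) atTop (𝓝 0) :=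
      Real.tendsto_exp_atBot.comp
        ((NNReal.tendsto_coe_atTop.2 tendsto_id).const_mul_atTop_of_neg (neg_neg_of_pos hα))
    obtain ⟨T, h1, h2, h3⟩ := ((hlim.eventually (gt_mem_nhds (by norm_num : (0 : ℝ) < 1 / 2))).and
      ((eventually_ge_atTop T₀).and (eventually_gt_atTop 0))).exists
    exact ⟨T, h2, h3, h1.le⟩
  have hTV' : ∀ x, φ x ≤ R → ∀ y, φ y ≤ R → TVLe κ (M.transition T x) (M.transition T y) :=
    fun x hx y hy => by
      have := tvLe_transition_add (hTV x hx y hy) (T - T₀)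
      rwa [add_tsub_cancel_of_le hT₀] at this
  -- A weight so small that the drift constant costs at most `1 - κ`.
  let b : ℝ := (1 - κ) / (2 * C + 1)
  have hb : 0 < b := div_pos (sub_pos.2 hκ1) (by positivity)
  have hbC : 2 * b * C ≤ 1 - κ := by
    have : b * (2 * C + 1) = 1 - κ := div_mul_cancel₀ _ (by positivity)
    nlinarith
  have hR : 0 < R := by positivity
  have hbR : 0 < b * R := mul_pos hb hR
  let γ : ℝ := max ((1 + κ) / 2) ((2 + 3 / 4 * (b * R)) / (2 + b * R))
  have hγ1 : (1 + κ) / 2 ≤ γ := le_max_left _ _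
  have hγR : 2 + 3 / 4 * (b * R) ≤ γ * (2 + b * R) :=
    (div_le_iff₀ (by positivity)).1 (le_max_right _ _)
  have hγlt : γ < 1 := max_lt (by linarith) ((div_lt_one (by positivity)).2 (by linarith))
  have hγ0 : 0 < γ := lt_of_lt_of_le (by linarith) hγ1
  have hlyapT : ∀ x, ∫ y, φ y ∂(M.transition T x) ≤ φ x / 2 + C := fun x => by
    have := mul_le_mul_of_nonneg_right hTα (zero_le_one.trans (hφ_one x))
    linarith [hlyap T x]
  have hstep : ∀ a > 0, ∀ f : X → ℝ, Measurable f →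
      (∀ x y, f x - f y ≤ a * (2 + b * φ x + b * φ y)) → ∀ x y,
      ∫ z, f z ∂(M.transition T x) - ∫ z, f z ∂(M.transition T y) ≤
        a * γ * (2 + b * φ x + b * φ y) := by
    intro a ha f hf h x y
    have := integral_sub_integral_le_of_harris (f := fun z => f z / a) hφ_one (hint T) hlyapT hTV'
      hb hbC (by simp only [R]; linarith) hR.le hγ1 (by linarith) hγR (hf.div_const a)
      (fun x y => by rw [← sub_div, div_le_iff₀ ha, mul_comm]; exact h x y) x y
    rw [integral_div, integral_div, ← sub_div, div_le_iff₀ ha] at this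
    linarith
  refine ⟨T, hT0, (1 + b) / b, by positivity, γ, hγ0, hγlt, fun f hf hfφ => ?_⟩
  have hfi : ∀ t x, Integrable f (M.transition t x) := fun t x =>
    (hint t x).mono' hf.aestronglyMeasurable (Eventually.of_forall hfφ)
  -- Since `|f| ≤ φ`, the weighted bound starts with constant `b⁻¹`; each step multiplies it by `γ`.
  -- At the end `2 ≤ φ x + φ y` turns the weight into `(1 + b)(φ x + φ y)`.
  have key : ∀ n : ℕ, ∀ x y,
      ∫ z, f z ∂(M.transition (n * T) x) - ∫ z, f z ∂(M.transition (n * T) y) ≤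
        b⁻¹ * γ ^ n * (2 + b * φ x + b * φ y) := by
    intro n
    induction n with
    | zero =>
      intro x y
      rw [Nat.cast_zero, zero_mul, transition_zero, transition_zero, integral_dirac' _ _ hf.stronglyMeasurable,
        integral_dirac' _ _ hf.stronglyMeasurable, pow_zero, mul_one]
      have h1 := (abs_le.1 (hfφ x)).2
      have h2 := (abs_le.1 (hfφ y)).1
      rw [inv_mul_eq_div, le_div_iff₀ hb]
      nlinarith
    | succ n ih =>
      intro x y
      have e : ∀ x, ∫ z, f z ∂(M.transition ((n + 1 : ℕ) * T) x) =
          ∫ w, ∫ z, f z ∂(M.transition (n * T) w) ∂(M.transition T x) := fun x => by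
        rw [show ((n + 1 : ℕ) * T : ℝ≥0) = T + n * T by push_cast; ring]
        exact integral_transition_add x _ _ (hfi _ x)
      rw [e, e, pow_succ, ← mul_assoc]
      exact hstep _ (by positivity) _ (measurable_integral_kernel hf) ih x y
  intro x y n
  refine (key n x y).trans ?_
  have h1 := hφ_one x
  have h2 := hφ_one y
  have e : (1 + b) / b * γ ^ n * (φ x + φ y) = b⁻¹ * γ ^ n * ((1 + b) * (φ x + φ y)) := by
    field_simp
  rw [e]
  refine mul_le_mul_of_nonneg_left ?_ (by positivity)
  linarith

lemma IsGeometric.integral_bind_sub_le {T : ℝ≥0} {A γ : ℝ} (h : M.IsGeometric φ T A γ)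
    {ρ : Measure X} [IsProbabilityMeasure ρ]
    (hρ : Integrable φ ρ) {n : ℕ} (hρn : Integrable φ (ρ.bind (M.transition (n * T)))) {f : X → ℝ}
    (hf : Measurable f) (hfφ : ∀ x, |f x| ≤ φ x) (x : X) :
    |∫ z, f z ∂(M.transition (n * T) x) - ∫ z, f z ∂(ρ.bind (M.transition (n * T)))| ≤
      A * γ ^ n * (φ x + ∫ z, φ z ∂ρ) := by
  have hfi : Integrable f (ρ.bind (M.transition (n * T))) :=
    hρn.mono' hf.aestronglyMeasurable (Eventually.of_forall hfφ)
  set g : X → ℝ := fun w => ∫ z, f z ∂(M.transition (n * T) w) with hg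
  have hbd : ∀ w, |g x - g w| ≤ A * γ ^ n * φ x + A * γ ^ n * φ w := fun w => by
    rw [abs_le]
    have h1 := h f hf hfφ x w n
    have h2 := h f hf hfφ w x n
    constructor <;> linarith
  have hgm : Measurable g := measurable_integral_kernel hf
  have hgi : Integrable (fun w => g x - g w) ρ :=
    ((integrable_const (A * γ ^ n * φ x)).add (hρ.const_mul (A * γ ^ n))).mono'
      (hgm.const_sub _).aestronglyMeasurable (Eventually.of_forall hbd)
  have hgi' : Integrable g ρ := ((integrable_const (g x)).sub hgi).congr
    (Eventually.of_forall fun w => by simp)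
  rw [integral_bind_kernel hfi]
  have e : ∫ w, (g x - g w) ∂ρ = g x - ∫ w, g w ∂ρ := by
    rw [integral_sub (integrable_const _) hgi']
    simp
  rw [← e, mul_add]
  exact abs_integral_le_const_add hρ hbd

end Ergodic

end StrongMarkovProcess

/-! ### Setwise limits of probability measures. -/

section SetwiseLimit

variable {X : Type*} [MeasurableSpace X]

/-- A sequence of probability measures that is uniformly Cauchy on measurable sets converges. -/
lemma exists_isProbabilityMeasure_forall_abs_sub_le (μ : ℕ → Measure X)
    [∀ n, IsProbabilityMeasure (μ n)] {ε : ℕ → ℝ} (hε : Tendsto ε atTop (𝓝 0))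
    (h : ∀ n m, n ≤ m → ∀ B, MeasurableSet B → |(μ n).real B - (μ m).real B| ≤ ε n) :
    ∃ π : Measure X, IsProbabilityMeasure π ∧
      ∀ n B, MeasurableSet B → |(μ n).real B - π.real B| ≤ ε n := by
  have hlim : ∀ B, ∃ l, MeasurableSet B → Tendsto (fun n => (μ n).real B) atTop (𝓝 l) := by
    intro B
    by_cases hB : MeasurableSet B
    · obtain ⟨l, hl⟩ := cauchySeq_tendsto_of_complete (cauchySeq_of_le_tendsto_0' ε
        (fun n m hnm => by rw [Real.dist_eq]; exact h n m hnm B hB) hε)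
      exact ⟨l, fun _ => hl⟩
    · exact ⟨0, fun h => absurd h hB⟩
  choose l hl using hlim
  have hl0 : ∀ B, MeasurableSet B → 0 ≤ l B := fun B hB =>
    ge_of_tendsto' (hl B hB) fun n => measureReal_nonneg
  have hle : ∀ n B, MeasurableSet B → |(μ n).real B - l B| ≤ ε n := fun n B hB =>
    le_of_tendsto ((tendsto_const_nhds.sub (hl B hB)).abs)
      ((eventually_ge_atTop n).mono fun m hm => h n m hm B hB)
  -- Countable additivity passes to the limit because the convergence is uniform over measurable
  -- sets.
  have hsum : ∀ f : ℕ → Set X, (∀ i, MeasurableSet (f i)) → Pairwise (Function.onFun Disjoint f) →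
      HasSum (fun i => l (f i)) (l (⋃ i, f i)) := by
    intro f hf hd
    rw [hasSum_iff_tendsto_nat_of_nonneg (fun i => hl0 _ (hf i))]
    let U : ℕ → Set X := fun k => ⋃ i ∈ Finset.range k, f i
    have hU : ∀ k, MeasurableSet (U k) := fun k => Finset.measurableSet_biUnion _ fun i _ => hf i
    have hUsum : ∀ n k, (μ n).real (U k) = ∑ i ∈ Finset.range k, (μ n).real (f i) := fun n k =>
      measureReal_biUnion_finset (fun i _ j _ hij => hd hij) fun i _ => hf i
    have hlU : ∀ k, ∑ i ∈ Finset.range k, l (f i) = l (U k) := fun k =>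
      tendsto_nhds_unique (tendsto_finsetSum _ fun i _ => hl _ (hf i))
        (by simpa only [hUsum] using hl _ (hU k))
    have hUU : ⋃ k, U k = ⋃ i, f i := by
      refine Set.Subset.antisymm (Set.iUnion_subset fun k => Set.iUnion₂_subset fun i _ =>
        Set.subset_iUnion f i) (Set.iUnion_subset fun i => ?_)
      exact (Set.subset_biUnion_of_mem (u := f) (Finset.self_mem_range_succ i)).trans
        (Set.subset_iUnion U (i + 1))
    have hUm : Monotone U := fun a b hab => Set.biUnion_subset_biUnion_left fun i hi =>
      Finset.mem_coe.2 (Finset.range_mono hab (Finset.mem_coe.1 hi))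
    simp only [hlU]
    refine Metric.tendsto_atTop.2 fun δ hδ => ?_
    obtain ⟨n, hn⟩ := (hε.eventually (gt_mem_nhds (show (0 : ℝ) < δ / 3 by positivity))).exists
    have hc : Tendsto (fun k => (μ n).real (U k)) atTop (𝓝 ((μ n).real (⋃ i, f i))) := by
      rw [← hUU]
      exact (ENNReal.tendsto_toReal (measure_ne_top _ _)).comp (tendsto_measure_iUnion_atTop hUm)
    obtain ⟨N, hN⟩ := Metric.tendsto_atTop.1 hc (δ / 3) (by positivity)
    refine ⟨N, fun k hk => ?_⟩
    have h1 := abs_le.1 (hle n (U k) (hU k))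
    have h2 := abs_le.1 (hle n (⋃ i, f i) (MeasurableSet.iUnion hf))
    have h3 := hN k hk
    rw [Real.dist_eq, abs_lt] at h3 ⊢
    constructor <;> linarith [h1.1, h1.2, h2.1, h2.2, h3.1, h3.2]
  have hempty : l ∅ = 0 := tendsto_nhds_unique (hl ∅ MeasurableSet.empty) (by simp)
  let π : Measure X := Measure.ofMeasurable (fun B _ => ENNReal.ofReal (l B)) (by simp [hempty])
    fun f hf hd => by
      rw [← (hsum f hf hd).tsum_eq, ENNReal.ofReal_tsum_of_nonneg (fun i => hl0 _ (hf i))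
        (hsum f hf hd).summable]
  have hπ : ∀ B, MeasurableSet B → π B = ENNReal.ofReal (l B) := fun B hB =>
    Measure.ofMeasurable_apply B hB
  refine ⟨π, ⟨?_⟩, fun n B hB => ?_⟩
  · rw [hπ _ MeasurableSet.univ, tendsto_nhds_unique (hl _ MeasurableSet.univ) (b := 1) (by simp),
      ENNReal.ofReal_one]
  · rw [measureReal_def (μ := π), hπ B hB, ENNReal.toReal_ofReal (hl0 B hB)]
    exact hle n B hB

end SetwiseLimit

namespace StrongMarkovProcess

/-! ### The invariant measure. -/

section Invariant

variable {X : Type u} [TopologicalSpace X] [MeasurableSpace X] {M : StrongMarkovProcess X}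
  {φ : X → ℝ} {T : ℝ≥0} {A γ C : ℝ}

/-- By Chapman–Kolmogorov, `P_{t+nT}(x, ·)` is the law after time `nT` started from `P_t(x, ·)`, so
the contraction applies for every `t`, multiple of `T` or not. -/
lemma IsGeometric.abs_measureReal_sub_le (h : M.IsGeometric φ T A γ) (hA : 0 < A) (hγ : 0 < γ)
    (hφ_one : ∀ x, 1 ≤ φ x)
    (hint : ∀ t x, Integrable φ (M.transition t x))
    (hC : ∀ (t : ℝ≥0) x, ∫ y, φ y ∂(M.transition t x) ≤ φ x + C) (x : X) (t : ℝ≥0) (n : ℕ)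
    {B : Set X} (hB : MeasurableSet B) :
    |(M.transition (n * T) x).real B - (M.transition (t + n * T) x).real B| ≤
      A * γ ^ n * (2 * φ x + C) := by
  have hf : Measurable (B.indicator (1 : X → ℝ)) := measurable_one.indicator hB
  have := h.integral_bind_sub_le (hint t x) (n := n) (by rw [← transition_add]; exact hint _ x) hf
    (fun z => by
      refine le_trans ?_ (hφ_one z)
      by_cases hz : z ∈ B <;> simp [hz]) x
  rw [← transition_add, integral_indicator_one hB, integral_indicator_one hB] at this
  refine this.trans (mul_le_mul_of_nonneg_left ?_ (by positivity))
  linarith [hC t x]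

lemma IsGeometric.exists_isInvariantMeasure [Nonempty X] (h : M.IsGeometric φ T A γ) (hA : 0 < A)
    (hγ : 0 < γ) (hγ1 : γ < 1) (hφ : Measurable φ) (hφ_one : ∀ x, 1 ≤ φ x)
    (hint : ∀ t x, Integrable φ (M.transition t x))
    (hC : ∀ (t : ℝ≥0) x, ∫ y, φ y ∂(M.transition t x) ≤ φ x + C) :
    ∃ π, M.IsInvariantMeasure π ∧ Integrable φ π := by
  obtain ⟨x⟩ := ‹Nonempty X›
  let μ : ℕ → Measure X := fun n => M.transition (n * T) x
  let ε : ℕ → ℝ := fun n => A * γ ^ n * (2 * φ x + C)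
  have hε : Tendsto ε atTop (𝓝 0) := by
    have := ((tendsto_pow_atTop_nhds_zero_of_lt_one hγ.le hγ1).const_mul A).mul_const (2 * φ x + C)
    simpa using this
  have hμ : ∀ n m, n ≤ m → ∀ B, MeasurableSet B → |(μ n).real B - (μ m).real B| ≤ ε n := by
    intro n m hnm B hB
    have := h.abs_measureReal_sub_le hA hγ hφ_one hint hC x ((m - n : ℕ) * T) n hB
    rwa [← add_mul, ← Nat.cast_add, Nat.sub_add_cancel hnm] at this
  obtain ⟨π, hπ, hμπ⟩ := exists_isProbabilityMeasure_forall_abs_sub_le μ hε hμ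
  have hTV1 : ∀ n, TVLe (ε n) (μ n) π := fun n => tvLe_of_measureReal_sub_le fun B hB =>
    (le_abs_self _).trans (hμπ n B hB)
  have hTV2 : ∀ n, TVLe (ε n) π (μ n) := fun n => (hTV1 n).symm
  refine ⟨π, ⟨hπ, fun t => ?_⟩, ?_⟩
  · have : IsProbabilityMeasure (π.bind (M.transition t)) := inferInstance
    refine Measure.ext fun B hB => ?_
    rw [← measureReal_eq_measureReal_iff]
    have hg : Measurable fun z => (M.transition t z).real B :=
      ((M.transition t).measurable_coe hB).ennreal_toReal
    have hgi : ∀ (ρ : Measure X) [IsProbabilityMeasure ρ],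
        (ρ.bind (M.transition t)).real B = ∫ z, (M.transition t z).real B ∂ρ := by
      intro ρ _
      have hi : Integrable (B.indicator (1 : X → ℝ)) (ρ.bind (M.transition t)) :=
        (integrable_const (1 : ℝ)).indicator hB
      rw [← integral_indicator_one hB, integral_bind_kernel hi]
      simp_rw [integral_indicator_one hB]
    -- Three comparisons, each within `ε n`: `π P_t` with `μ_n P_t`, then with `μ_n`, then with `π`.
    have hbound : ∀ n, |(π.bind (M.transition t)).real B - π.real B| ≤ 3 * ε n := by
      intro n
      have h1 := hTV1 n _ hg (fun _ => measureReal_nonneg) fun _ => measureReal_le_one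
      have h2 := hTV2 n _ hg (fun _ => measureReal_nonneg) fun _ => measureReal_le_one
      rw [← hgi, ← hgi] at h1 h2
      have h3 := abs_le.1 (hμπ n B hB)
      have h4 := abs_le.1 (h.abs_measureReal_sub_le hA hγ hφ_one hint hC x t n hB)
      have e : (μ n).bind (M.transition t) = M.transition (t + n * T) x := by
        rw [add_comm, transition_add]
      rw [e] at h1 h2
      rw [abs_le]
      have h4' : -(ε n) ≤ (μ n).real B - (M.transition (t + n * T) x).real B ∧
        (μ n).real B - (M.transition (t + n * T) x).real B ≤ ε n := h4
      constructor <;> linarith [h3.1, h3.2, h4'.1, h4'.2]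
    have hlim : Tendsto (fun n => 3 * ε n) atTop (𝓝 0) := by simpa using hε.const_mul 3
    have h0 := ge_of_tendsto' hlim hbound
    exact sub_eq_zero.1 (abs_nonpos_iff.1 h0)
  · have h0 : ∀ z, 0 ≤ φ z := fun z => zero_le_one.trans (hφ_one z)
    refine (lintegral_ofReal_ne_top_iff_integrable hφ.aestronglyMeasurable
      (Eventually.of_forall h0)).1 ?_
    have hN : ∀ N : ℕ, ∫⁻ z, ENNReal.ofReal (min (φ z) N) ∂π ≤ ENNReal.ofReal (φ x + C) := by
      intro N
      have hm : Measurable fun z => min (φ z) N := hφ.min measurable_const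
      have ha : ∀ z, 0 ≤ min (φ z) N := fun z => le_min (h0 z) N.cast_nonneg
      -- The bound `N + 1` keeps the interval `[0, N + 1]` nondegenerate at `N = 0`.
      have hb : ∀ z, min (φ z) N ≤ N + 1 := fun z => (min_le_right _ _).trans (by linarith)
      rw [← ofReal_integral_eq_lintegral_ofReal (integrable_of_mem_Icc hm ha hb)
        (Eventually.of_forall ha)]
      refine ENNReal.ofReal_le_ofReal ?_
      have hb' : ∀ n, ∫ z, min (φ z) N ∂π ≤ φ x + C + ε n * (N + 1 - 0) := fun n => by
        have h1 := (hTV2 n).integral_sub_le hm (by positivity) ha hb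
        have h2 : ∫ z, min (φ z) N ∂(μ n) ≤ ∫ z, φ z ∂(μ n) :=
          integral_mono (integrable_of_mem_Icc hm ha hb) (hint _ x) fun z => min_le_left _ _
        linarith [hC (n * T) x]
      have hlim : Tendsto (fun n => φ x + C + ε n * (N + 1 - 0)) atTop (𝓝 (φ x + C)) := by
        simpa using tendsto_const_nhds.add (hε.mul_const ((N : ℝ) + 1 - 0))
      exact ge_of_tendsto' hlim hb'
    have hsup : ∀ z, ENNReal.ofReal (φ z) = ⨆ N : ℕ, ENNReal.ofReal (min (φ z) N) := fun z => by
      refine le_antisymm ?_ (iSup_le fun N => ENNReal.ofReal_le_ofReal (min_le_left _ _))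
      obtain ⟨N, hN⟩ := exists_nat_ge (φ z)
      exact le_iSup_of_le N (by rw [min_eq_left hN])
    simp_rw [hsup]
    rw [lintegral_iSup (fun N => (hφ.min measurable_const).ennreal_ofReal) fun a b hab z =>
      ENNReal.ofReal_le_ofReal (min_le_min_left _ (Nat.cast_le.2 hab))]
    exact ((iSup_le hN).trans_lt ENNReal.ofReal_lt_top).ne

end Invariant

end StrongMarkovProcess

/-! ### Successive maximal coupling. -/

section Gluing

variable {Ω Ω' : Type*} [MeasurableSpace Ω] [MeasurableSpace Ω']

/-- A measure dominated by an image measure is the image of a dominated measure. -/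
lemma exists_le_map_eq (r : Measure Ω) [IsFiniteMeasure r] {H : Ω → Ω'} (hH : Measurable H)
    {e : Measure Ω'} (he : e ≤ r.map H) : ∃ p ≤ r, p.map H = e := by
  have hfin : IsFiniteMeasure e := isFiniteMeasure_of_le _ he
  -- The density is at most 1 almost everywhere; the truncation makes this hold everywhere, so its
  -- pullback along `H` also stays below 1.
  set d : Ω' → ℝ≥0∞ := fun y => min (e.rnDeriv (r.map H) y) 1 with hd
  have hdm : Measurable d := (Measure.measurable_rnDeriv _ _).min measurable_const
  have hed : (r.map H).withDensity d = e := by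
    refine (withDensity_congr_ae ?_).trans
      (Measure.withDensity_rnDeriv_eq e (r.map H) (Measure.absolutelyContinuous_of_le he))
    filter_upwards [Measure.rnDeriv_le_one_of_le he] with y hy
    exact min_eq_left hy
  refine ⟨r.withDensity (d ∘ H), ?_, ?_⟩
  · calc r.withDensity (d ∘ H) ≤ r.withDensity 1 :=
          withDensity_mono (Eventually.of_forall fun ω => min_le_right _ _)
      _ = r := withDensity_one
  · rw [← hed]
    ext s hs
    rw [Measure.map_apply hH hs, withDensity_apply _ (hH hs), withDensity_apply _ hs,
      setLIntegral_map hs hdm hH]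
    rfl

/-- Two measures with the same image under `H₁`, `H₂` are coupled with `H₁ ω.1 = H₂ ω.2`. -/
lemma exists_coupling_of_map_eq [StandardBorelSpace Ω] [Nonempty Ω] [MeasurableEq Ω']
    {p p' : Measure Ω}
    [IsFiniteMeasure p] [IsFiniteMeasure p'] {H₁ H₂ : Ω → Ω'} (hH₁ : Measurable H₁)
    (hH₂ : Measurable H₂) (h : p.map H₁ = p'.map H₂) :
    ∃ γ : Measure (Ω × Ω), γ.map Prod.fst = p ∧ γ.map Prod.snd = p' ∧
      ∀ᵐ ω ∂γ, H₁ ω.1 = H₂ ω.2 := by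
  have key : ∀ (p : Measure Ω) [IsFiniteMeasure p] (H : Ω → Ω') (_ : Measurable H),
      ∃ κ : Kernel Ω' Ω, IsMarkovKernel κ ∧ (p.map H).bind κ = p ∧
        ∀ᵐ y ∂(p.map H), ∀ᵐ ω ∂(κ y), H ω = y := by
    intro p _ H hH
    have hm : Measurable fun ω => (H ω, ω) := hH.prodMk measurable_id
    set ρ := p.map fun ω => (H ω, ω) with hρ
    have hfst : ρ.fst = p.map H := Measure.fst_map_prodMk measurable_id
    have hsnd : ρ.snd = p := by
      rw [hρ, Measure.snd_map_prodMk hH]; exact Measure.map_id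
    have hdis := ρ.disintegrate ρ.condKernel
    refine ⟨ρ.condKernel, inferInstance, ?_, ?_⟩
    · rw [← hfst, ← Measure.snd_compProd, hdis, hsnd]
    · rw [← hfst]
      have : ∀ᵐ z ∂(ρ.fst ⊗ₘ ρ.condKernel), H z.2 = z.1 := by
        rw [hdis, hρ]
        exact (ae_map_iff hm.aemeasurable
          (measurableSet_eq_fun (hH.comp measurable_snd) measurable_fst)).2
          (Eventually.of_forall fun ω => rfl)
      exact Measure.ae_ae_of_ae_compProd this
  obtain ⟨κ₁, _, h₁, hae₁⟩ := key p H₁ hH₁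
  obtain ⟨κ₂, _, h₂, hae₂⟩ := key p' H₂ hH₂
  rw [← h] at h₂ hae₂
  -- Draw the common image first, then the two points independently from their conditional laws
  -- given it.
  refine ⟨(p.map H₁).bind (κ₁ ×ₖ κ₂), ?_, ?_, ?_⟩
  · rw [Measure.map_comp _ _ measurable_fst, ← Kernel.fst_eq, Kernel.fst_prod, h₁]
  · rw [Measure.map_comp _ _ measurable_snd, ← Kernel.snd_eq, Kernel.snd_prod, h₂]
  · refine Measure.ae_comp_of_ae_ae
      (measurableSet_eq_fun (hH₁.comp measurable_fst) (hH₂.comp measurable_snd)) ?_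
    filter_upwards [hae₁, hae₂] with y hy₁ hy₂
    rw [Kernel.prod_apply]
    have e₁ : ∀ᵐ z ∂((κ₁ y).prod (κ₂ y)), H₁ z.1 = y :=
      Measure.quasiMeasurePreserving_fst.ae hy₁
    have e₂ : ∀ᵐ z ∂((κ₁ y).prod (κ₂ y)), H₂ z.2 = y :=
      Measure.quasiMeasurePreserving_snd.ae hy₂
    filter_upwards [e₁, e₂] with z hz₁ hz₂
    rw [hz₁, hz₂]

lemma measure_le_of_add_le_add_right {a b c : Measure Ω} [IsFiniteMeasure c]
    (h : a + c ≤ b + c) : a ≤ b := by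
  intro s
  have := h s
  rw [Measure.add_apply, Measure.add_apply] at this
  exact (ENNReal.add_le_add_iff_right (measure_ne_top c s)).1 this

/-- Peeling off `μ` parts that lie, at stage `n`, over the part of `m n` not already covered. -/
lemma exists_peeling (μ : Measure Ω) [IsFiniteMeasure μ] {S : Ω → Ω} (hS : Measurable S)
    {G : ℕ → Ω → Ω} (hG : ∀ n, Measurable (G n)) (hGS : ∀ n, G (n + 1) = S ∘ G n)
    {m q : ℕ → Measure Ω} (hq0 : q 0 = 0) (hq : ∀ n, q (n + 1) = (m n).map S)
    (hqm : ∀ n, q n ≤ m n) (hm : ∀ n, m n ≤ μ.map (G n)) :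
    ∃ p R : ℕ → Measure Ω, R 0 = μ ∧ (∀ n, R n = R (n + 1) + p n) ∧
      (∀ n, (p n).map (G n) = m n - q n) ∧
      ∀ n, (R (n + 1)).map (G n) + m n = μ.map (G n) := by
  have hmfin : ∀ n, IsFiniteMeasure (m n) := fun n => isFiniteMeasure_of_le _ (hm n)
  have hqfin : ∀ n, IsFiniteMeasure (q n) := fun n => isFiniteMeasure_of_le _ (hqm n)
  have hex : ∀ (n : ℕ) (r : Measure Ω), ∃ p, IsFiniteMeasure r → m n - q n ≤ r.map (G n) →
      p ≤ r ∧ p.map (G n) = m n - q n := by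
    intro n r
    by_cases h : IsFiniteMeasure r ∧ m n - q n ≤ r.map (G n)
    · obtain ⟨hr, he⟩ := h
      obtain ⟨p, hp, hpe⟩ := exists_le_map_eq r (hG n) he
      exact ⟨p, fun _ _ => ⟨hp, hpe⟩⟩
    · exact ⟨0, fun h₁ h₂ => absurd ⟨h₁, h₂⟩ h⟩
  choose P hP using hex
  let R : ℕ → Measure Ω := fun n => Nat.rec μ (fun n r => r - P n r) n
  have hRs : ∀ n, R (n + 1) = R n - P n (R n) := fun n => rfl
  have hR0 : R 0 = μ := rfl
  clear_value R
  -- Before stage `n` the residual and the already covered part `q n` add up to the image of `μ`.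
  -- Removing mass over `m n - q n` raises the covered part to `m n`, and pushing by `S` restores
  -- the invariant for stage `n + 1`.
  have hstep : ∀ n, IsFiniteMeasure (R n) → (R n).map (G n) + q n = μ.map (G n) →
      R n = R (n + 1) + P n (R n) ∧ (P n (R n)).map (G n) = m n - q n ∧
      (R (n + 1)).map (G n) + m n = μ.map (G n) := by
    intro n hfin hinv
    have he : m n - q n ≤ (R n).map (G n) := by
      refine measure_le_of_add_le_add_right (c := q n) ?_
      rw [Measure.sub_add_cancel_of_le (hqm n), hinv]
      exact hm n
    obtain ⟨hle, hmap⟩ := hP n (R n) hfin he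
    have hPfin : IsFiniteMeasure (P n (R n)) := isFiniteMeasure_of_le _ hle
    have hadd : R n = R (n + 1) + P n (R n) := by
      rw [hRs, Measure.sub_add_cancel_of_le hle]
    refine ⟨hadd, hmap, ?_⟩
    rw [← hinv]
    conv_rhs => rw [hadd]
    rw [Measure.map_add _ _ (hG n), hmap, add_assoc, Measure.sub_add_cancel_of_le (hqm n)]
  have hinv : ∀ n, IsFiniteMeasure (R n) ∧ (R n).map (G n) + q n = μ.map (G n) := by
    intro n
    induction n with
    | zero =>
      rw [hR0, hq0, add_zero]
      exact ⟨inferInstance, rfl⟩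
    | succ n ih =>
      obtain ⟨hfin, hi⟩ := ih
      obtain ⟨-, -, h⟩ := hstep n hfin hi
      refine ⟨isFiniteMeasure_of_le (R n) ((hRs n).trans_le Measure.sub_le), ?_⟩
      rw [hq, hGS, ← Measure.map_map hS (hG n), ← Measure.map_map hS (hG n),
        ← Measure.map_add _ _ hS, h]
  exact ⟨fun n => P n (R n), R, hR0, fun n => (hstep n (hinv n).1 (hinv n).2).1,
    fun n => (hstep n (hinv n).1 (hinv n).2).2.1, fun n => (hstep n (hinv n).1 (hinv n).2).2.2⟩

/-- Telescoping: as the residual mass vanishes, each residual is the sum of the pieces still to be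
removed. -/
lemma eq_sum_of_eq_add {p R : ℕ → Measure Ω} (h : ∀ n, R n = R (n + 1) + p n)
    (hR : Tendsto (fun n => R n Set.univ) atTop (𝓝 0)) (n : ℕ) :
    R n = Measure.sum fun k => p (k + n) := by
  ext s hs
  rw [Measure.sum_apply _ hs]
  have hpart : ∀ M, R n s = (∑ k ∈ Finset.range M, p (k + n) s) + R (M + n) s := by
    intro M
    induction M with
    | zero => simp
    | succ M ih =>
      rw [ih, Finset.sum_range_succ, h (M + n), Measure.add_apply, show M + 1 + n = M + n + 1 by ring]
      ring
  have h0 : Tendsto (fun M => R (M + n) s) atTop (𝓝 0) :=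
    tendsto_of_tendsto_of_tendsto_of_le_of_le tendsto_const_nhds
      (hR.comp (tendsto_add_atTop_nat n)) (fun _ => zero_le) fun _ => measure_mono (Set.subset_univ s)
  have hlim := (ENNReal.tendsto_nat_tsum fun k => p (k + n) s).add h0
  rw [add_zero] at hlim
  refine tendsto_nhds_unique ?_ hlim
  simp_rw [← hpart]
  exact tendsto_const_nhds

/-- Two probability measures whose images under `G n` share the part `m n` can be coupled so that
the residual parts control the event that the images have not met up to stage `n`. -/
lemma exists_successive_coupling [StandardBorelSpace Ω] [Nonempty Ω] (μ ν : Measure Ω)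
    [IsProbabilityMeasure μ] [IsProbabilityMeasure ν] {S : Ω → Ω} (hS : Measurable S)
    {G : ℕ → Ω → Ω} (hG : ∀ n, Measurable (G n)) (hGS : ∀ n, G (n + 1) = S ∘ G n)
    {m : ℕ → Measure Ω} (hmS : ∀ n, (m n).map S ≤ m (n + 1)) (hμ : ∀ n, m n ≤ μ.map (G n))
    (hν : ∀ n, m n ≤ ν.map (G n)) (hm1 : Tendsto (fun n => m n Set.univ) atTop (𝓝 1)) :
    ∃ Pr : Measure (Ω × Ω), Pr.map Prod.fst = μ ∧ Pr.map Prod.snd = ν ∧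
      ∃ R R' : ℕ → Measure Ω, (∀ n, (R n).map (G n) + m n = μ.map (G n)) ∧
        (∀ n, (R' n).map (G n) + m n = ν.map (G n)) ∧
        ∀ n (N : Set (Ω × Ω)), (∀ k ≤ n, ∀ ω ∈ N, G k ω.1 ≠ G k ω.2) →
          ∀ f : Ω → ℝ≥0∞, Measurable f →
            ∫⁻ ω in N, f ω.1 ∂Pr ≤ ∫⁻ ω, f ω ∂(R n) ∧
            ∫⁻ ω in N, f ω.2 ∂Pr ≤ ∫⁻ ω, f ω ∂(R' n) := by
  have hmfin : ∀ n, IsFiniteMeasure (m n) := fun n => isFiniteMeasure_of_le _ (hμ n)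
  -- Mass matched at one stage remains matched after applying `S`, so only `m n - q n` is new.
  let q : ℕ → Measure Ω := fun n => Nat.casesOn n 0 fun k => (m k).map S
  have hq0 : q 0 = 0 := rfl
  have hq : ∀ n, q (n + 1) = (m n).map S := fun n => rfl
  have hqm : ∀ n, q n ≤ m n := by
    rintro (_ | n)
    · exact Measure.zero_le _
    · exact hmS n
  have hvanish : ∀ (μ : Measure Ω) [IsProbabilityMeasure μ] (R : ℕ → Measure Ω),
      (∀ n, (R (n + 1)).map (G n) + m n = μ.map (G n)) →
      Tendsto (fun n => R n Set.univ) atTop (𝓝 0) := by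
    intro μ _ R hR
    rw [← tendsto_add_atTop_iff_nat 1]
    have hsub := ENNReal.Tendsto.sub (tendsto_const_nhds (x := (1 : ℝ≥0∞))) hm1
      (Or.inl ENNReal.one_ne_top)
    rw [tsub_self] at hsub
    refine hsub.congr fun n => ?_
    have h := congrArg (fun κ : Measure Ω => κ Set.univ) (hR n)
    simp only [Measure.add_apply, Measure.map_apply (hG n) MeasurableSet.univ, Set.preimage_univ,
      measure_univ] at h
    rw [← h, ENNReal.add_sub_cancel_right (measure_ne_top _ _)]
  obtain ⟨p, R, hR0, hRs, hp, hRm⟩ := exists_peeling μ hS hG hGS hq0 hq hqm hμ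
  obtain ⟨p', R', hR0', hRs', hp', hRm'⟩ := exists_peeling ν hS hG hGS hq0 hq hqm hν
  have hsum := eq_sum_of_eq_add hRs (hvanish μ R hRm)
  have hsum' := eq_sum_of_eq_add hRs' (hvanish ν R' hRm')
  have hpfin : ∀ n, IsFiniteMeasure (p n) := fun n => isFiniteMeasure_of_le μ (by
    rw [← hR0, hsum 0]; exact Measure.le_sum _ n)
  have hpfin' : ∀ n, IsFiniteMeasure (p' n) := fun n => isFiniteMeasure_of_le ν (by
    rw [← hR0', hsum' 0]; exact Measure.le_sum _ n)
  choose γ hγ₁ hγ₂ hγ using fun n =>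
    exists_coupling_of_map_eq (hG n) (hG n) ((hp n).trans (hp' n).symm)
  have hbound : ∀ (pr : Ω × Ω → Ω) (_ : Measurable pr) (p R : ℕ → Measure Ω)
      (_ : ∀ n, (γ n).map pr = p n) (_ : ∀ n, R n = Measure.sum fun k => p (k + n)),
      ∀ n (N : Set (Ω × Ω)), (∀ k ≤ n, ∀ ω ∈ N, G k ω.1 ≠ G k ω.2) →
          ∀ f : Ω → ℝ≥0∞, Measurable f →
            ∫⁻ ω in N, f (pr ω) ∂(Measure.sum γ) ≤ ∫⁻ ω, f ω ∂(R (n + 1)) := by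
    intro pr hpr p R hγp hR n N hN f hf
    rw [Measure.restrict_sum_of_countable, lintegral_sum_measure, hR, lintegral_sum_measure,
      ← Summable.sum_add_tsum_nat_add' (k := n + 1) ENNReal.summable]
    -- Piece `k` lives where the `G k` images agree, so pieces up to stage `n` do not charge `N`;
    -- what remains is the residual with index `n + 1`.
    have hzero : ∑ k ∈ Finset.range (n + 1), ∫⁻ ω in N, f (pr ω) ∂(γ k) = 0 := by
      refine Finset.sum_eq_zero fun k hk => setLIntegral_measure_zero _ _ ?_
      refine measure_mono_null (fun ω hω => ?_) (hγ k)
      exact hN k (Nat.lt_succ_iff.1 (Finset.mem_range.1 hk)) ω hω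
    rw [hzero, zero_add]
    refine ENNReal.tsum_le_tsum fun k => ?_
    rw [← hγp, lintegral_map hf hpr]
    exact setLIntegral_le_lintegral _ _
  refine ⟨Measure.sum γ, ?_, ?_, fun n => R (n + 1), fun n => R' (n + 1), hRm, hRm',
    fun n N hN f hf => ⟨hbound Prod.fst measurable_fst p R hγ₁ hsum n N hN f hf,
      hbound Prod.snd measurable_snd p' R' hγ₂ hsum' n N hN f hf⟩⟩
  · rw [Measure.map_sum measurable_fst.aemeasurable, ← hR0, hsum 0]
    simp only [hγ₁, add_zero]
  · rw [Measure.map_sum measurable_snd.aemeasurable, ← hR0', hsum' 0]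
    simp only [hγ₂, add_zero]

end Gluing

/-! ### The excess over the common part of two measures. -/

section Infimum

variable {X : Type*} [MeasurableSpace X]

/-- The weighted mass of the excess of `a` over `a ⊓ b` is bounded by the weighted variation. -/
lemma lintegral_le_of_add_inf_eq {a b d : Measure X} [IsFiniteMeasure a] [IsFiniteMeasure b]
    {φ : X → ℝ} (hφ : Measurable φ) (hφ0 : ∀ x, 0 ≤ φ x) (ha : Integrable φ a)
    (hb : Integrable φ b) {D : ℝ}
    (h : ∀ f : X → ℝ, Measurable f → (∀ x, |f x| ≤ φ x) → ∫ x, f x ∂a - ∫ x, f x ∂b ≤ D)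
    (hd : d + a ⊓ b = a) : ∫⁻ x, ENNReal.ofReal (φ x) ∂d ≤ ENNReal.ofReal D := by
  obtain ⟨s, hs, hs₁, hs₂⟩ := hahn_decomposition (μ := a) (ν := b)
  -- On a Hahn set the smaller measure is `b`, off it `a`; hence the excess is dominated by `a - b`
  -- on `s`, tested there by the indicator of `s` times `φ`.
  have hinf : a.restrict sᶜ + b.restrict s ≤ a ⊓ b := by
    have hba : b.restrict s ≤ a.restrict s :=
      restrict_le_restrict_of_forall_subset hs fun t ht hts => hs₁ t ht hts
    have hab : a.restrict sᶜ ≤ b.restrict sᶜ :=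
      restrict_le_restrict_of_forall_subset hs.compl fun t ht hts => hs₂ t ht hts
    refine le_inf ?_ ?_
    · calc a.restrict sᶜ + b.restrict s ≤ a.restrict sᶜ + a.restrict s := add_le_add le_rfl hba
        _ = a := Measure.restrict_compl_add_restrict hs
    · calc a.restrict sᶜ + b.restrict s ≤ b.restrict sᶜ + b.restrict s := add_le_add hab le_rfl
        _ = b := Measure.restrict_compl_add_restrict hs
  have hle : d + b.restrict s ≤ a.restrict s := by
    refine measure_le_of_add_le_add_right (c := a.restrict sᶜ) ?_
    calc d + b.restrict s + a.restrict sᶜ = d + (a.restrict sᶜ + b.restrict s) := by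
          rw [add_assoc, add_comm (b.restrict s)]
      _ ≤ d + a ⊓ b := add_le_add le_rfl hinf
      _ = a.restrict s + a.restrict sᶜ := by rw [hd, Measure.restrict_add_restrict_compl hs]
  have hint := lintegral_mono' hle (le_refl fun x => ENNReal.ofReal (φ x))
  rw [lintegral_add_measure,
    ← ofReal_integral_eq_lintegral_ofReal hb.restrict (Eventually.of_forall hφ0),
    ← ofReal_integral_eq_lintegral_ofReal ha.restrict (Eventually.of_forall hφ0)] at hint
  have hD := h (s.indicator φ) (hφ.indicator hs) fun x => by
    by_cases hx : x ∈ s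
    · rw [Set.indicator_of_mem hx, abs_of_nonneg (hφ0 x)]
    · rw [Set.indicator_of_notMem hx, abs_zero]; exact hφ0 x
  rw [integral_indicator hs, integral_indicator hs] at hD
  have hb0 : 0 ≤ ∫ x in s, φ x ∂b := integral_nonneg hφ0
  calc ∫⁻ x, ENNReal.ofReal (φ x) ∂d
      ≤ ENNReal.ofReal (∫ x in s, φ x ∂a) - ENNReal.ofReal (∫ x in s, φ x ∂b) :=
        ENNReal.le_sub_of_add_le_right ENNReal.ofReal_ne_top hint
    _ = ENNReal.ofReal (∫ x in s, φ x ∂a - ∫ x in s, φ x ∂b) := (ENNReal.ofReal_sub _ hb0).symm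
    _ ≤ ENNReal.ofReal D := ENNReal.ofReal_le_ofReal hD

end Infimum

namespace StrongMarkovProcess

/-! ### Path laws with general initial measures, and the coupling. -/

section LawFrom

variable {X : Type u} [TopologicalSpace X] [MeasurableSpace X] (M : StrongMarkovProcess X)

lemma lawFrom_mono {a b : Measure X} (h : a ≤ b) : M.lawFrom a ≤ M.lawFrom b :=
  Measure.le_iff.2 fun s hs => by
    unfold lawFrom
    rw [Measure.bind_apply hs M.law.aemeasurable, Measure.bind_apply hs M.law.aemeasurable]
    exact lintegral_mono' h le_rfl

lemma lawFrom_add (a b : Measure X) : M.lawFrom (a + b) = M.lawFrom a + M.lawFrom b := by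
  ext s hs
  unfold lawFrom
  rw [Measure.add_apply, Measure.bind_apply hs M.law.aemeasurable,
    Measure.bind_apply hs M.law.aemeasurable, Measure.bind_apply hs M.law.aemeasurable,
    lintegral_add_measure]

lemma lawFrom_univ (a : Measure X) : M.lawFrom a Set.univ = a Set.univ := by
  unfold lawFrom
  rw [Measure.bind_apply MeasurableSet.univ M.law.aemeasurable]
  simp

lemma lintegral_eval_lawFrom (a : Measure X) (t : ℝ≥0) {f : X → ℝ≥0∞} (hf : Measurable f) :
    ∫⁻ ω, f (ω.eval t) ∂(M.lawFrom a) = ∫⁻ x, ∫⁻ y, f y ∂(M.transition t x) ∂a := by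
  unfold lawFrom
  have hm : Measurable fun ω : CadlagPath X => f (ω.eval t) :=
    hf.comp (CadlagPath.measurable_eval t)
  rw [Measure.lintegral_bind M.law.aemeasurable hm.aemeasurable]
  exact lintegral_congr fun x => (M.lintegral_transition x t hf).symm

end LawFrom

section Coupling

variable {X : Type u} [TopologicalSpace X] [MeasurableSpace X] {M : StrongMarkovProcess X}
  {φ : X → ℝ} {C : ℝ}

/-- The `φ`-mass at time `t` of a measure on paths whose image under the shift by `r ≤ t` has
the excess of `a` over `c` as initial distribution. -/
lemma lintegral_eval_le_of_map_shift (hφ : Measurable φ) (hφ_one : ∀ x, 1 ≤ φ x) (hC0 : 0 ≤ C)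
    (hint : ∀ t x, Integrable φ (M.transition t x))
    (hC : ∀ (t : ℝ≥0) x, ∫ y, φ y ∂(M.transition t x) ≤ φ x + C)
    {a c : Measure X} [IsFiniteMeasure a] (hca : c ≤ a) {R : Measure (CadlagPath X)} {r t : ℝ≥0}
    (hrt : r ≤ t) (hR : R.map (CadlagPath.shift r) + M.lawFrom c = M.lawFrom a) :
    ∫⁻ ω, ENNReal.ofReal (φ (ω.eval t)) ∂(R) ≤
      ENNReal.ofReal (1 + C) * ∫⁻ x, ENNReal.ofReal (φ x) ∂(a - c) := by
  have h0 : ∀ x, 0 ≤ φ x := fun x => zero_le_one.trans (hφ_one x)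
  have hcfin : IsFiniteMeasure c := isFiniteMeasure_of_le _ hca
  have hlfin : IsFiniteMeasure (M.lawFrom c) := ⟨by rw [lawFrom_univ]; exact measure_lt_top c _⟩
  -- The path law is additive in its initial measure, and the finite common term cancels.
  have hmap : R.map (CadlagPath.shift r) = M.lawFrom (a - c) := by
    have h : R.map (CadlagPath.shift r) + M.lawFrom c = M.lawFrom (a - c) + M.lawFrom c := by
      rw [hR, ← lawFrom_add, Measure.sub_add_cancel_of_le hca]
    exact le_antisymm (measure_le_of_add_le_add_right h.le) (measure_le_of_add_le_add_right h.ge)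
  have hev : ∀ ω : CadlagPath X, ω.eval t = (CadlagPath.shift r ω).eval (t - r) := fun ω => by
    rw [CadlagPath.eval_shift, add_tsub_cancel_of_le hrt]
  have hm : Measurable fun ω : CadlagPath X => ENNReal.ofReal (φ (ω.eval (t - r))) :=
    hφ.ennreal_ofReal.comp (CadlagPath.measurable_eval _)
  simp_rw [hev]
  rw [← lintegral_map hm (CadlagPath.measurable_shift r), hmap,
    M.lintegral_eval_lawFrom _ _ hφ.ennreal_ofReal, ← lintegral_const_mul _ hφ.ennreal_ofReal]
  refine lintegral_mono fun x => ?_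
  rw [← ofReal_integral_eq_lintegral_ofReal (hint _ x) (Eventually.of_forall h0),
    ← ENNReal.ofReal_mul (by linarith)]
  refine ENNReal.ofReal_le_ofReal ((hC _ x).trans ?_)
  nlinarith [hφ_one x]

variable [PolishSpace X] [BorelSpace X]

/-- The common part at stage `n` is the path law started from `P_{nT}(x, ·) ⊓ π`; paths matched at
that stage coincide from time `nT` on. -/
lemma IsGeometric.exists_isCoupling {T : ℝ≥0} {A γ : ℝ} (h : M.IsGeometric φ T A γ) (hT : 0 < T)
    (hγ : 0 < γ) (hγ1 : γ < 1) (hφ : Measurable φ) (hφ_one : ∀ x, 1 ≤ φ x) (hC0 : 0 ≤ C)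
    (hint : ∀ t x, Integrable φ (M.transition t x))
    (hC : ∀ (t : ℝ≥0) x, ∫ y, φ y ∂(M.transition t x) ≤ φ x + C)
    {π : Measure X} (hπ : M.IsInvariantMeasure π) (hφπ : Integrable φ π) (x : X) :
    ∃ Pr : Measure (CadlagPath X × CadlagPath X),
      M.IsCoupling (Measure.dirac x) π Pr Prod.fst Prod.snd ∧
      ∀ t : ℝ≥0, ∫⁻ ω in {ω | ω.1.eval t ≠ ω.2.eval t},
          ENNReal.ofReal (φ (ω.1.eval t) + φ (ω.2.eval t)) ∂Pr ≤
        ENNReal.ofReal (2 * (1 + C) * (A * γ ^ ⌊t / T⌋₊ * (φ x + ∫ y, φ y ∂π))) := by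
  obtain ⟨hπp, hinv⟩ := hπ
  have hinv' : ∀ t, π.bind (M.transition t) = π := fun t => hinv t
  have h0 : ∀ x, 0 ≤ φ x := fun x => zero_le_one.trans (hφ_one x)
  have hstd : StandardBorelSpace (CadlagPath X) := CadlagPath.standardBorelSpace X
  set D : ℕ → ℝ := fun n => A * γ ^ n * (φ x + ∫ y, φ y ∂π) with hD
  let a : ℕ → Measure X := fun n => M.transition (n * T) x
  let c : ℕ → Measure X := fun n => a n ⊓ π
  have hap : ∀ n, IsProbabilityMeasure (a n) := fun n => inferInstanceAs
    (IsProbabilityMeasure (M.transition (n * T) x))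
  have hca : ∀ n, c n ≤ a n := fun n => inf_le_left
  have hcπ : ∀ n, c n ≤ π := fun n => inf_le_right
  have hcfin : ∀ n, IsFiniteMeasure (c n) := fun n => isFiniteMeasure_of_le _ (hcπ n)
  have hgeo : ∀ n f, Measurable f → (∀ x, |f x| ≤ φ x) →
      |∫ y, f y ∂(a n) - ∫ y, f y ∂π| ≤ D n := fun n f hf hfφ => by
    have := h.integral_bind_sub_le hφπ (n := n) (by rw [hinv']; exact hφπ) hf hfφ x
    rwa [hinv'] at this
  have hda : ∀ n, ∫⁻ y, ENNReal.ofReal (φ y) ∂(a n - c n) ≤ ENNReal.ofReal (D n) := fun n =>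
    lintegral_le_of_add_inf_eq hφ h0 (hint _ x) hφπ
      (fun f hf hfφ => (abs_le.1 (hgeo n f hf hfφ)).2) (Measure.sub_add_cancel_of_le (hca n))
  have hdπ : ∀ n, ∫⁻ y, ENNReal.ofReal (φ y) ∂(π - c n) ≤ ENNReal.ofReal (D n) := fun n =>
    lintegral_le_of_add_inf_eq (b := a n) hφ h0 hφπ (hint _ x)
      (fun f hf hfφ => by linarith [(abs_le.1 (hgeo n f hf hfφ)).1])
      (by rw [inf_comm]; exact Measure.sub_add_cancel_of_le (hcπ n))
  have hDlim : Tendsto D atTop (𝓝 0) := by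
    have := ((tendsto_pow_atTop_nhds_zero_of_lt_one hγ.le hγ1).const_mul A).mul_const
      (φ x + ∫ y, φ y ∂π)
    simpa using this
  have hc1 : Tendsto (fun n => c n Set.univ) atTop (𝓝 1) := by
    have hd0 : Tendsto (fun n => (a n - c n) Set.univ) atTop (𝓝 0) := by
      have hlim := ENNReal.tendsto_ofReal hDlim
      rw [ENNReal.ofReal_zero] at hlim
      refine tendsto_of_tendsto_of_tendsto_of_le_of_le tendsto_const_nhds hlim
        (fun _ => zero_le) fun n => le_trans ?_ (hda n)
      rw [← lintegral_one]
      exact lintegral_mono fun y => by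
        rw [← ENNReal.ofReal_one]; exact ENNReal.ofReal_le_ofReal (hφ_one y)
    have hsub := ENNReal.Tendsto.sub (tendsto_const_nhds (x := (1 : ℝ≥0∞))) hd0
      (Or.inl ENNReal.one_ne_top)
    rw [tsub_zero] at hsub
    refine hsub.congr fun n => ?_
    have hadd := congrArg (fun κ : Measure X => κ Set.univ) (Measure.sub_add_cancel_of_le (hca n))
    simp only [Measure.add_apply, measure_univ] at hadd
    rw [← hadd, ENNReal.add_sub_cancel_left (measure_ne_top _ _)]
  -- Matched mass stays common: `P_T` is monotone, carries `a n` to `a (n + 1)` and fixes `π`.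
  have hcT : ∀ n, (c n).bind (M.transition T) ≤ c (n + 1) := fun n => by
    have hmono : ∀ b, c n ≤ b → (c n).bind (M.transition T) ≤ b.bind (M.transition T) :=
      fun b hb => Measure.le_iff.2 fun s hs => by
        rw [Measure.bind_apply hs (M.transition T).aemeasurable,
          Measure.bind_apply hs (M.transition T).aemeasurable]
        exact lintegral_mono' hb le_rfl
    refine le_inf ?_ ?_
    · have : a (n + 1) = (a n).bind (M.transition T) := by
        rw [← M.transition_add]
        simp only [a, Nat.cast_add, Nat.cast_one, add_mul, one_mul]
      rw [this]
      exact hmono _ (hca n)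
    · exact (hmono _ (hcπ n)).trans_eq (hinv' T)
  have hμp : IsProbabilityMeasure (M.lawFrom (Measure.dirac x)) :=
    ⟨by rw [lawFrom_univ, measure_univ]⟩
  have hνp : IsProbabilityMeasure (M.lawFrom π) := ⟨by rw [lawFrom_univ, measure_univ]⟩
  have hne : Nonempty (CadlagPath X) := nonempty_of_isProbabilityMeasure (M.lawFrom π)
  have hμG : ∀ n : ℕ, (M.lawFrom (Measure.dirac x)).map (CadlagPath.shift (n * T)) =
      M.lawFrom (a n) := fun n => by
    rw [M.lawFrom_map_shift, Measure.dirac_bind (M.transition _).measurable]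
  have hνG : ∀ n : ℕ, (M.lawFrom π).map (CadlagPath.shift (n * T)) = M.lawFrom π := fun n => by
    rw [M.lawFrom_map_shift, hinv']
  obtain ⟨Pr, hPr₁, hPr₂, R, R', hR, hR', hbound⟩ :=
    exists_successive_coupling (M.lawFrom (Measure.dirac x)) (M.lawFrom π)
      (CadlagPath.measurable_shift T) (G := fun n => CadlagPath.shift (n * T))
      (fun n => CadlagPath.measurable_shift _)
      (fun n => funext fun ω => by
        rw [Function.comp_apply, CadlagPath.shift_shift, Nat.cast_add, Nat.cast_one, add_mul,
          one_mul])
      (m := fun n => M.lawFrom (c n))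
      (fun n => by rw [M.lawFrom_map_shift]; exact M.lawFrom_mono (hcT n))
      (fun n => by rw [hμG]; exact M.lawFrom_mono (hca n))
      (fun n => by rw [hνG]; exact M.lawFrom_mono (hcπ n))
      (by simpa only [lawFrom_univ] using hc1)
  refine ⟨Pr, ⟨⟨?_⟩, measurable_fst, measurable_snd, hPr₁, hPr₂⟩, fun t => ?_⟩
  · have := congrArg (fun κ : Measure (CadlagPath X) => κ Set.univ) hPr₁
    simpa only [Measure.map_apply measurable_fst MeasurableSet.univ, Set.preimage_univ,
      measure_univ] using this
  set n := ⌊t / T⌋₊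
  have hnt : n * T ≤ t := (le_div_iff₀ hT).1 (Nat.floor_le zero_le)
  have hfm : Measurable fun ω : CadlagPath X => ENNReal.ofReal (φ (ω.eval t)) :=
    hφ.ennreal_ofReal.comp (CadlagPath.measurable_eval t)
  -- Agreement of the paths from some `kT ≤ t` on would force agreement at `t`.
  obtain ⟨h₁, h₂⟩ := hbound n {ω | ω.1.eval t ≠ ω.2.eval t} (fun k hk ω hω heq => hω (by
    have hkt : (k : ℝ≥0) * T ≤ t := le_trans (by gcongr) hnt
    have := congrArg (CadlagPath.eval (t - k * T)) heq
    simpa only [CadlagPath.eval_shift, add_tsub_cancel_of_le hkt] using this)) _ hfm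
  have e₁ := lintegral_eval_le_of_map_shift hφ hφ_one hC0 hint hC (hca n) hnt
    ((hR n).trans (hμG n))
  have e₂ := lintegral_eval_le_of_map_shift hφ hφ_one hC0 hint hC (hcπ n) hnt
    ((hR' n).trans (hνG n))
  simp_rw [ENNReal.ofReal_add (h0 _) (h0 _)]
  have hfm₁ : Measurable fun ω : CadlagPath X × CadlagPath X =>
      ENNReal.ofReal (φ (ω.1.eval t)) := hfm.comp measurable_fst
  rw [lintegral_add_left hfm₁]
  calc _ ≤ ENNReal.ofReal (1 + C) * ENNReal.ofReal (D n) +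
        ENNReal.ofReal (1 + C) * ENNReal.ofReal (D n) :=
        add_le_add ((h₁.trans e₁).trans (by gcongr; exact hda n))
          ((h₂.trans e₂).trans (by gcongr; exact hdπ n))
    _ = _ := by
        rw [← two_mul, ← ENNReal.ofReal_mul (by linarith), ← ENNReal.ofReal_ofNat,
          ← ENNReal.ofReal_mul (by norm_num), ← mul_assoc]

lemma IsGeometric.admitsExponentialCoupling {T : ℝ≥0} {A γ : ℝ} (h : M.IsGeometric φ T A γ)
    (hT : 0 < T) (hA : 0 < A) (hγ : 0 < γ) (hγ1 : γ < 1) (hφ : Measurable φ)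
    (hφ_one : ∀ x, 1 ≤ φ x) (hC0 : 0 ≤ C) (hint : ∀ t x, Integrable φ (M.transition t x))
    (hC : ∀ (t : ℝ≥0) x, ∫ y, φ y ∂(M.transition t x) ≤ φ x + C)
    {π : Measure X} (hπ : M.IsInvariantMeasure π) (hφπ : Integrable φ π) :
    M.AdmitsExponentialCoupling φ := by
  have hI : 0 ≤ ∫ y, φ y ∂π := integral_nonneg fun x => zero_le_one.trans (hφ_one x)
  have hT' : (0 : ℝ) < T := hT
  have hlog : Real.log γ < 0 := Real.log_neg hγ hγ1
  refine ⟨π, hπ, 2 * (1 + C) * (A * γ⁻¹ * (1 + ∫ y, φ y ∂π)), by positivity,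
    -Real.log γ / T, div_pos (neg_pos.2 hlog) hT', fun x => ?_⟩
  obtain ⟨Pr, hPr, hbd⟩ := h.exists_isCoupling hT hγ hγ1 hφ hφ_one hC0 hint hC hπ hφπ x
  refine ⟨_, inferInstance, Pr, Prod.fst, Prod.snd, hPr, fun t => (hbd t).trans ?_⟩
  -- Rounding `t / T` down costs at most one factor `γ⁻¹`.
  have hpow : γ ^ ⌊t / T⌋₊ ≤ γ⁻¹ * Real.exp (-(-Real.log γ / T) * t) := by
    have hfl : (t / T : ℝ) ≤ ⌊t / T⌋₊ + 1 := by
      exact_mod_cast (Nat.lt_floor_add_one (t / T)).le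
    rw [← Real.exp_log hγ, ← Real.exp_nat_mul, ← Real.exp_neg, ← Real.exp_add, Real.log_exp,
      Real.exp_le_exp]
    have := mul_le_mul_of_nonpos_right hfl hlog.le
    calc (⌊t / T⌋₊ : ℝ) * Real.log γ = (⌊t / T⌋₊ + 1) * Real.log γ - Real.log γ := by ring
      _ ≤ (t / T : ℝ) * Real.log γ - Real.log γ := by linarith
      _ = _ := by ring
  have hφI : φ x + ∫ y, φ y ∂π ≤ (1 + ∫ y, φ y ∂π) * φ x := by
    nlinarith [hφ_one x]
  refine ENNReal.ofReal_le_ofReal ?_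
  calc _ ≤ 2 * (1 + C) * (A * (γ⁻¹ * Real.exp (-(-Real.log γ / T) * t)) *
        ((1 + ∫ y, φ y ∂π) * φ x)) := by
        have := hφ_one x
        gcongr
    _ = _ := by ring

end Coupling

end StrongMarkovProcess

theorem theorem2p2 {X : Type u} [MetricSpace X] [LocallyCompactSpace X]
    [SecondCountableTopology X] [Nonempty X] [MeasurableSpace X] [BorelSpace X]
    (M : StrongMarkovProcess X)
    (φ : X → ℝ) (hφ : Measurable φ) (hφ_one : ∀ x, 1 ≤ φ x)
    (K : Set X) (hK : IsClosed K) (α : ℝ) (hα : 0 < α)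
    (hitting_bound : ∀ (x : X) (t : ℝ≥0),
      ∫⁻ ω in {ω | (t : WithTop ℝ≥0) < StrongMarkovProcess.hittingTime K ω},
          ENNReal.ofReal (φ (CadlagPath.eval t ω)) ∂(M.law x)
        ≤ ENNReal.ofReal (Real.exp (-α * t) * φ x))
    (tail_bound : Tendsto
      (fun c : ℝ => ⨆ x ∈ K, ⨆ t : ℝ≥0,
        ∫⁻ ω in {ω | c < φ (CadlagPath.eval t ω)},
          ENNReal.ofReal (φ (CadlagPath.eval t ω)) ∂(M.law x))
      atTop (𝓝 0))
    (doeblin : (∀ c : ℝ, 1 ≤ c → M.DoeblinOn {x | φ x ≤ c}) ∨ M.ExtendedDoeblinOn K) :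
    M.AdmitsExponentialCoupling φ := by
  have hpolish : PolishSpace X := polishSpace_of_locallyCompactSpace X
  have hvisit := M.exists_isVisit hK hitting_bound
  obtain ⟨C, hCK⟩ := M.exists_lintegral_transition_le hφ tail_bound
  have hφt : ∀ (t : ℝ≥0) x, Integrable φ (M.transition t x) ∧
      ∫ y, φ y ∂(M.transition t x) ≤ Real.exp (-α * t) * φ x + C := fun t x => by
    obtain ⟨τ, hτ, hbound⟩ := hvisit x
    exact StrongMarkovProcess.integrable_transition_and_integral_le hφ hφ_one (Real.exp_pos _).le
      (StrongMarkovProcess.lintegral_transition_le_exp_add hφ hCK hτ (hbound t))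
  have hlevel : ∀ c : ℝ, ∃ T : ℝ≥0, ∃ κ : ℝ, 0 ≤ κ ∧ κ < 1 ∧ ∀ x, φ x ≤ c → ∀ y, φ y ≤ c →
      TVLe κ (M.transition T x) (M.transition T y) := by
    intro c
    rcases doeblin with hD | hD
    -- The Doeblin condition is given only for levels at least 1; lower level sets sit inside these.
    · obtain ⟨T, κ, hκ0, hκ1, h⟩ := (hD (max c 1) (le_max_right _ _)).exists_tvLe
      exact ⟨T, κ, hκ0, hκ1, fun x hx y hy =>
        h x (hx.trans (le_max_left _ _)) y (hy.trans (le_max_left _ _))⟩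
    · exact StrongMarkovProcess.exists_tvLe_level hφ hD
        (StrongMarkovProcess.exists_forall_isVisit_half hα hφ_one hvisit) hCK c
  have hint := fun t x => (hφt t x).1
  have hgrowth : ∀ (t : ℝ≥0) x, ∫ y, φ y ∂(M.transition t x) ≤ φ x + C := fun t x => by
    refine (hφt t x).2.trans (add_le_add (mul_le_of_le_one_left
      (zero_le_one.trans (hφ_one x)) (Real.exp_le_one_iff.2 ?_)) le_rfl)
    have := mul_nonneg hα.le t.coe_nonneg
    linarith
  obtain ⟨T, hT, A, hA, γ, hγ, hγ1, hgeo⟩ := StrongMarkovProcess.exists_isGeometric hα hφ_one hint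
    C.coe_nonneg (fun t x => (hφt t x).2) hlevel
  obtain ⟨π, hπ, hφπ⟩ := hgeo.exists_isInvariantMeasure hA hγ hγ1 hφ hφ_one hint hgrowth
  exact hgeo.admitsExponentialCoupling hT hA hγ hγ1 hφ hφ_one C.coe_nonneg hint hgrowth hπ hφπ
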